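/- **Setting.** There are $K\ge 1$ arms and $T\ge 2$ rounds. An oblivious adversary fixes (possibly at random, but independently of the learner's random choices) loss vectors $\ell_1,\dots,\ell_T\in[0,1]^K$; put $\ell_0=\mathbf 0$. In round $t$ the learner draws an arm $i_t$ and observes only $c_t=\ell_{t,i_t}$. Let $$\mathrm{Reg}=\max_{i\in[K]}\mathbb E\Big[\sum_{t=1}^T\ell_{t,i_t}-\sum_{t=1}^T\ell_{t,i}\Big],\qquad V_1=\mathbb E\Big[\sum_{t=1}^T\|\ell_t-\ell_{t-1}\|_1\Big].$$ **Algorithm** (parameters $\eta>0$ and $\alpha,\beta\in(0,1)$). Let $\Delta_K$ be the probability simplex, $\psi(x)=\frac1\eta\sum_i\ln\frac1{x_i}+\frac K\eta\sum_i x_i\ln x_i$ and $D_\psi(x,y)=\psi(x)-\psi(y)-\langle\nabla\psi(y),x-y\rangle$. Let $\rho_i(t)$ be the last round $s\le t$ with $i_s=i$ ($0$ if there is none). Start with $x_1'=x_1=w_1$ uniform, $m_1=\mathbf 0$ and $S_0=[K]$. In round $t=1,\dots,T$: 1. Draw $i_t\sim w_t$, observe $c_t$, and let $\tau=\tau(t)=\max\{r\le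 t: i_r\in S_{r-1}\}$ and $S_t=\{i: x_{t,i}<\beta\}$ (the minority arms; the other arms are the majority). 2. Let $\hat\ell_{t,i}=\frac{\ell_{t,i}-m_{t,i}}{w_{t,i}}\mathbf 1\{i_t=i\}+m_{t,i}$; let $m_{t+1,i}=c_\tau$ for $i\in S_t$ and $m_{t+1,i}=\ell_{\rho_i(t),i}$ for $i\notin S_t$. 3. Let $x_{t+1}'=\arg\min_{x\in\Delta_K}\langle x,\hat\ell_t\rangle+D_\psi(x,x_t')$ and $x_{t+1}=\arg\min_{x\in\Delta_K}\langle x,m_{t+1}\rangle+D_\psi(x,x_{t+1}')$. 4. With $\alpha_{t+1}=\frac{\alpha(1-c_\tau)}{1+\alpha(1-c_\tau)}$, let $w_{t+1,i}=(1-\alpha_{t+1})x_{t+1,i}$ for $i\in S_t\setminus\{i_\tau\}$, let $w_{t+1,i}=x_{t+1,i}+\alpha_{t+1}\sum_{j\in S_t\setminus\{i_\tau\}}x_{t+1,j}$ for $i=i_\tau$, and let $w_{t+1,i}=x_{t+1,i}$ for all other $i$. **Theorem.** (a) There is a universal constant $C$ such that for all $K\ge1$, $T\ge2$, all $0<\eta\le\min\{\frac1K,\frac1{162}\}$,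 all $\beta\in(0,1)$, and $\alpha=8\eta$, the algorithm satisfies, against every oblivious adversary, $$\mathrm{Reg}\le C\Big(\frac{K\ln T}{\eta}+\frac{\eta V_1}{K\beta}+\eta\sqrt{\beta TV_1}\Big).$$ (b) There are universal constants $C,p$ such that for all $K\ge 1$, $T\ge 2$, $V\ge 0$ there are parameters $\eta,\beta$ in the above range such that, with $\alpha=8\eta$, against every oblivious adversary with $V_1=V$, $$\mathrm{Reg}\le C(\ln T)^p\big(K^{1/3}V_1^{1/3}T^{1/6}+K^2\big).$$ That is, $\mathrm{Reg}=\tilde O(K^{1/3}V_1^{1/3}T^{1/6}+K^2)$ with tuned parameters. (c) The main term in (b) satisfies $K^{1/3}V_1^{1/3}T^{1/6}\le\sqrt{KV_1}$ whenever $V_1\ge T/K$, with strict inequality when $V_1>T/K$. -/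

import Mathlib

open MeasureTheory Finset

noncomputable section

namespace PathLengthBandit

/-- The points of the probability simplex on `K` arms with positive coordinates. The regularizer
below is finite exactly at these points of the simplex (`ln (1 / x_i) = +∞` at `x_i = 0`), so
minimizing over the whole simplex means minimizing over this set. -/
def simplex (K : ℕ) : Set (Fin K → ℝ) := {x | (∀ i, 0 < x i) ∧ ∑ i, x i = 1}

/-- The hybrid regularizer `ψ(x) = (1/η) ∑ ln (1/x_i) + (K/η) ∑ x_i ln x_i`. -/
def regularizer {K : ℕ} (η : ℝ) (x : Fin K → ℝ) : ℝ :=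
  1 / η * ∑ i, Real.log (1 / x i) + (K : ℝ) / η * ∑ i, x i * Real.log (x i)

/-- The Bregman divergence `D_ψ(x, y) = ψ(x) - ψ(y) - ⟨∇ψ(y), x - y⟩`. -/
def bregman {K : ℕ} (ψ : (Fin K → ℝ) → ℝ) (x y : Fin K → ℝ) : ℝ :=
  ψ x - ψ y - fderiv ℝ ψ y (x - y)

/-- The mirror descent update `argmin_x ⟨x, g⟩ + D_ψ(x, y)` over the simplex. -/
def mdUpdate {K : ℕ} (η : ℝ) (g y : Fin K → ℝ) : Fin K → ℝ :=
  Classical.epsilon fun x => x ∈ simplex K ∧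
    IsMinOn (fun z => ∑ i, z i * g i + bregman (regularizer η) z y) (simplex K) x

/-- `lastRound a i t` is the last round `s` with `1 ≤ s ≤ t` in which arm `i` was played
according to `a`, and `0` if there is none. -/
def lastRound {K : ℕ} (a : ℕ → Fin K) (i : Fin K) (t : ℕ) : ℕ :=
  Nat.findGreatest (fun s => a s = i) t

/-- What the algorithm stores between rounds `t` and `t + 1`. -/
structure State (K : ℕ) where
  /-- the auxiliary iterate `x'_{t+1}` -/
  x' : Fin K → ℝ
  /-- the iterate `x_{t+1}` -/
  x : Fin K → ℝ
  /-- the sampling distribution `w_{t+1}` of round `t + 1` -/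
  w : Fin K → ℝ
  /-- the optimistic prediction `m_{t+1}` -/
  m : Fin K → ℝ
  /-- the minority group `S_t` -/
  S : Finset (Fin K)
  /-- the last round `τ(t) ≤ t` in which an arm of the then current minority group was played -/
  τ : ℕ

/-- The state before the first round: uniform distributions, zero prediction, `S_0 = [K]`. -/
def State.init (K : ℕ) : State K where
  x' := fun _ => 1 / (K : ℝ)
  x := fun _ => 1 / (K : ℝ)
  w := fun _ => 1 / (K : ℝ)
  m := fun _ => 0
  S := Finset.univ
  τ := 0

open Classical in
/-- The computation of the algorithm at the end of round `t ≥ 1`, where `s` is the state before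
round `t`. Here `a r` is the arm played in round `r` and `c r` is the observed loss of that arm;
only rounds `1 ≤ r ≤ t` are used. -/
def State.step {K : ℕ} (η α β : ℝ) (a : ℕ → Fin K) (c : ℕ → ℝ) (t : ℕ) (s : State K) :
    State K :=
  let τ : ℕ := if a t ∈ s.S then t else s.τ
  let S : Finset (Fin K) := Finset.univ.filter fun i => s.x i < β
  let lossEst : Fin K → ℝ := fun i =>
    (if a t = i then (c t - s.m i) / s.w i else 0) + s.m i
  let m : Fin K → ℝ := fun i =>
    if i ∈ S then c τ
    else if lastRound a i t = 0 then 0 else c (lastRound a i t)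
  let x' : Fin K → ℝ := mdUpdate η lossEst s.x'
  let x : Fin K → ℝ := mdUpdate η m x'
  let αt : ℝ := α * (1 - c τ) / (1 + α * (1 - c τ))
  let w : Fin K → ℝ := fun i =>
    if i ∈ S \ {a τ} then x i * (1 - αt)
    else if i = a τ then x i + αt * ∑ j ∈ S \ {a τ}, x j
    else x i
  { x' := x', x := x, w := w, m := m, S := S, τ := τ }

/-- The state after `t` rounds, as a function of the played arms `a 1, …, a t` and of the
observed losses `c 1, …, c t`. -/
def state {K : ℕ} (η α β : ℝ) (a : ℕ → Fin K) (c : ℕ → ℝ) : ℕ → State K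
  | 0 => State.init K
  | t + 1 => (state η α β a c t).step η α β a c (t + 1)

/-- The stored round is `τ(t) = max {τ ≤ t : i_τ ∈ S_{τ-1}}`. -/
theorem state_τ_isGreatest {K : ℕ} (η α β : ℝ) (a : ℕ → Fin K) (c : ℕ → ℝ) (t : ℕ) :
    IsGreatest {r : ℕ | 1 ≤ r ∧ r ≤ t + 1 ∧ a r ∈ (state η α β a c (r - 1)).S}
      (state η α β a c (t + 1)).τ := by
  classical
  have key : ∀ t, (state η α β a c (t + 1)).τ =
      if a (t + 1) ∈ (state η α β a c t).S then t + 1 else (state η α β a c t).τ := by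
    intro t
    rfl
  induction t with
  | zero =>
    have h : a 1 ∈ (state η α β a c 0).S := by simp [state, State.init]
    rw [key 0, if_pos h]
    exact ⟨⟨le_rfl, le_rfl, h⟩, fun r hr => hr.2.1⟩
  | succ t ih =>
    rw [key (t + 1)]
    split_ifs with h
    · exact ⟨⟨by omega, le_rfl, h⟩, fun r hr => hr.2.1⟩
    · refine ⟨⟨ih.1.1, by have := ih.1.2.1; omega, ih.1.2.2⟩, fun r hr => ih.2 ⟨hr.1, ?_, hr.2.2⟩⟩
      rcases Nat.lt_or_ge r (t + 2) with h' | h'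
      · omega
      · have hr2 : r = t + 2 := le_antisymm hr.2.1 h'
        subst hr2
        exact absurd hr.2.2 h

variable {K : ℕ} {Ω : Type*}

/-- What is known to learner and adversary together when the arm of round `t + 1` is drawn:
the losses of all `T` rounds and the arms played in rounds `1, …, t`. -/
@[reducible] def information (T : ℕ) (loss : ℕ → Ω → Fin K → ℝ) (act : ℕ → Ω → Fin K) (t : ℕ) :
    MeasurableSpace Ω :=
  (⨆ s ∈ Finset.Icc 1 T, MeasurableSpace.comap (loss s) inferInstance) ⊔
    ⨆ s ∈ Finset.Icc 1 t, MeasurableSpace.comap (act s) inferInstance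

open Classical in
/-- `T` rounds of the algorithm against a (possibly randomized) oblivious adversary with losses in
`[0, 1]`: `loss t ω i` is the loss of arm `i` in round `t` and `act t ω` the arm played in
round `t`, for `1 ≤ t ≤ T`. Given the whole loss sequence and the arms played before, the arm of
round `t + 1` is drawn from the distribution `w_{t+1}` that the algorithm has computed from its
own observations. That the losses of later rounds may be included in the conditioning is the
obliviousness of the adversary. -/
structure IsObliviousRun [MeasurableSpace Ω] (η α β : ℝ) (T : ℕ) (μ : Measure Ω)
    (loss : ℕ → Ω → Fin K → ℝ) (act : ℕ → Ω → Fin K) : Prop where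
  measurable_loss : ∀ t ∈ Finset.Icc 1 T, Measurable (loss t)
  measurable_act : ∀ t ∈ Finset.Icc 1 T, Measurable (act t)
  loss_mem : ∀ t ∈ Finset.Icc 1 T, ∀ ω i, loss t ω i ∈ Set.Icc (0 : ℝ) 1
  sampling : ∀ t < T, ∀ k : Fin K,
    μ[fun ω => if act (t + 1) ω = k then (1 : ℝ) else 0 | information T loss act t] =ᵐ[μ]
      fun ω => (state η α β (fun s => act s ω) (fun s => loss s ω (act s ω)) t).w k

/-- The (pseudo) regret `max_i E[∑_{t=1}^T ℓ_{t,i_t} - ∑_{t=1}^T ℓ_{t,i}]`. -/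
def regret [MeasurableSpace Ω] (μ : Measure Ω) (T : ℕ)
    (loss : ℕ → Ω → Fin K → ℝ) (act : ℕ → Ω → Fin K) : ℝ :=
  ⨆ i : Fin K, ∫ ω, (∑ t ∈ Finset.Icc 1 T, loss t ω (act t ω) -
    ∑ t ∈ Finset.Icc 1 T, loss t ω i) ∂μ

/-- The 1-norm path-length `E[∑_{t=1}^T ‖ℓ_t - ℓ_{t-1}‖₁]` with the convention `ℓ_0 = 0`. -/
def pathLength [MeasurableSpace Ω] (μ : Measure Ω) (T : ℕ) (loss : ℕ → Ω → Fin K → ℝ) : ℝ :=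
  ∫ ω, ∑ t ∈ Finset.Icc 1 T, ∑ i, |loss t ω i - (if t = 1 then 0 else loss (t - 1) ω i)| ∂μ

end PathLengthBandit

end

/-!
The regret splits into three parts: the estimated regret of the mirror descent iterates `x_t`, the
effect of sampling from the biased `w_t` instead of `x_t`, and deviations with conditional mean `0`.
Everything except the last part is bounded for a fixed sequence of losses and played arms
(`sum_loss_le`), and the adversary being oblivious makes the deviations vanish in expectation
(`integral_deviation`).

*Mirror descent.* By the optimality condition `IsProx` of each step, the estimated regret telescopes
up to `η (c_t - m_t) ^ 2 / (1 + K x_t)` at the arm played (`omd_round`), where `c_t` is the observed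
loss and `m_t` its prediction, and consecutive iterates agree up to a factor of `4` (`run_ratio`).

*Majority arms.* There `1 + K x_t` is at least of order `K β`, and the prediction error is at most
the variation of the loss since the arm was last played. The intervals between plays of an arm are
disjoint, so the sum is at most of order `η V / (K β)` on every path (`majority_error_le`,
`sum_sinceLast_le`).

*Minority arms.* Let `c` be the stored loss and `c'` the loss observed in a minority round. The
prediction error costs `3 η (c' - c) ^ 2`. The bias contributes `8 η (1 - c) (c'' - c')`, where `c''`
is the current loss of the last minority arm. If `c''` were `c`, this would be a telescoping term
minus `4 η (c' - c) ^ 2`, which pays for the prediction error (`minority_error_le`). What remains is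
`8 η` times the sum of `|c'' - c|`, the switching cost.

*Switching cost.* Cut the rounds into blocks of length `L`. Pairs of consecutive minority rounds in
different blocks number at most `T / L` and cost at most `1` each. Within a block, the cost is at most
the variation over the block of the arm stored; a minority arm is drawn with probability at most
`4 β`, except through the bias, which repeats the stored arm in an `8 η`-fraction of the minority
rounds and is absorbed (`minority_cutVariation_le`). In expectation this gives `T / L + β L V`, up to
constants (`expSwitchCost_le_blocks`), and `L = √(T / (β V))` gives `√(β T V)` (`expSwitchCost_le`).

Measurability of the random state needs the minimizers to depend measurably on the data, which
follows from the Lusin–Souslin theorem (`measurable_of_isProx`). The tuned bound balances the three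
terms (`exists_tuning`).
-/

noncomputable section

namespace PathLengthBandit

/-! ### The regularizer and the mirror descent update -/

/-- Up to the factor `1/η` and an additive constant, the derivative in one coordinate of
`regularizer η`. The constant `K` is dropped because only differences of values at different
points or coordinates matter. -/
def mirrorMap (K : ℕ) (x : ℝ) : ℝ := K * Real.log x - 1 / x

/-- The one-dimensional Bregman divergence of `x ↦ -ln x + K x ln x`, which is `η` times one summand
of `bregman (regularizer η)`. -/
def coordDiv (K : ℕ) (x y : ℝ) : ℝ :=
  (-Real.log x + K * (x * Real.log x)) - (-Real.log y + K * (y * Real.log y))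
    - (mirrorMap K y + K) * (x - y)

theorem mirrorMap_strictMonoOn (K : ℕ) : StrictMonoOn (mirrorMap K) (Set.Ioi 0) := by
  intro x hx y hy hxy
  have hx' : (0 : ℝ) < x := hx
  have h1 : Real.log x ≤ Real.log y := Real.log_le_log hx' hxy.le
  have h2 : 1 / y < 1 / x := one_div_lt_one_div_of_lt hx' hxy
  have h3 : (K : ℝ) * Real.log x ≤ K * Real.log y := by gcongr
  unfold mirrorMap
  linarith

theorem one_div_sub_one_div_le {K : ℕ} {x y : ℝ} (hy : 0 < y) (hxy : y ≤ x) :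
    1 / y - 1 / x ≤ mirrorMap K x - mirrorMap K y := by
  have h1 : Real.log y ≤ Real.log x := Real.log_le_log hy hxy
  have h3 : (K : ℝ) * Real.log y ≤ K * Real.log x := by gcongr
  unfold mirrorMap
  linarith

theorem hasFDerivAt_regularizer {K : ℕ} (η : ℝ) {y : Fin K → ℝ} (hy : ∀ i, 0 < y i) :
    HasFDerivAt (regularizer η)
      (∑ i, (1 / η * (mirrorMap K (y i) + K)) • (ContinuousLinearMap.proj i : (Fin K → ℝ) →L[ℝ] ℝ))
      y := by
  have h1 : ∀ i, HasDerivAt (fun t : ℝ => 1 / η * Real.log (1 / t) + (K : ℝ) / η * (t * Real.log t))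
      (1 / η * (mirrorMap K (y i) + K)) (y i) := by
    intro i
    have hne := (hy i).ne'
    have e1 : HasDerivAt (fun t : ℝ => Real.log (1 / t)) (-(y i)⁻¹) (y i) := by
      simpa only [one_div, Real.log_inv] using (Real.hasDerivAt_log hne).fun_neg
    have e2 : HasDerivAt (fun t : ℝ => t * Real.log t) (Real.log (y i) + 1) (y i) :=
      Real.hasDerivAt_mul_log hne
    refine ((e1.const_mul (1 / η)).add (e2.const_mul ((K : ℝ) / η))).congr_deriv ?_
    unfold mirrorMap
    field_simp
    ring
  have h2 := HasFDerivAt.fun_sum (u := Finset.univ)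
    (fun i _ => (h1 i).comp_hasFDerivAt y
      (ContinuousLinearMap.proj (R := ℝ) (φ := fun _ : Fin K => ℝ) i).hasFDerivAt)
  refine h2.congr_of_eventuallyEq (Filter.Eventually.of_forall fun z => ?_)
  simp [regularizer, Finset.sum_add_distrib, Finset.mul_sum]

theorem simplex_le_one {K : ℕ} {x : Fin K → ℝ} (hx : x ∈ simplex K) (i : Fin K) : x i ≤ 1 := by
  rw [← hx.2]
  exact Finset.single_le_sum (fun j _ => (hx.1 j).le) (Finset.mem_univ i)

/-- The entropy part of the regularizer is bounded on the simplex, so the log-barrier part alone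
forces a near-minimizer away from the boundary. -/
theorem regularizer_ge {K : ℕ} {η : ℝ} (hη : 0 < η) {z : Fin K → ℝ} (hz : z ∈ simplex K)
    (i : Fin K) : 1 / η * (Real.log (1 / z i) - K ^ 2) ≤ regularizer η z := by
  have h1 : Real.log (1 / z i) ≤ ∑ j, Real.log (1 / z j) := by
    refine Finset.single_le_sum (f := fun j => Real.log (1 / z j)) (fun j _ => ?_)
      (Finset.mem_univ i)
    exact Real.log_nonneg (one_le_one_div (hz.1 j) (simplex_le_one hz j))
  have h2 : -(K : ℝ) ≤ ∑ j, z j * Real.log (z j) := by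
    have : ∑ j : Fin K, (-1 : ℝ) ≤ ∑ j, z j * Real.log (z j) := by
      refine Finset.sum_le_sum fun j _ => ?_
      have h3 := Real.one_sub_inv_le_log_of_pos (hz.1 j)
      have h4 := mul_le_mul_of_nonneg_left h3 (hz.1 j).le
      have h5 : z j * (1 - (z j)⁻¹) = z j - 1 := by
        have := (hz.1 j).ne'
        field_simp
      linarith [hz.1 j]
    simpa using this
  have h3 : (K : ℝ) * -(K : ℝ) ≤ K * ∑ j, z j * Real.log (z j) := by gcongr
  have h4 : regularizer η z =
      1 / η * (∑ j, Real.log (1 / z j) + K * ∑ j, z j * Real.log (z j)) := by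
    unfold regularizer
    ring
  rw [h4]
  gcongr
  nlinarith

theorem exists_isMinOn_simplex {K : ℕ} {η : ℝ} (hη : 0 < η) (g : Fin K → ℝ) {y : Fin K → ℝ}
    (hy : y ∈ simplex K) :
    ∃ x, x ∈ simplex K ∧
      IsMinOn (fun z => ∑ i, z i * g i + bregman (regularizer η) z y) (simplex K) x := by
  set lin : (Fin K → ℝ) → ℝ := fun z =>
    ∑ i, z i * g i - fderiv ℝ (regularizer η) y (z - y) - regularizer η y with hlin
  have hlinc : Continuous lin := by
    have : Continuous fun z : Fin K → ℝ => fderiv ℝ (regularizer η) y (z - y) :=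
      (fderiv ℝ (regularizer η) y).continuous.comp (continuous_id.sub continuous_const)
    fun_prop
  set F : (Fin K → ℝ) → ℝ := fun z => ∑ i, z i * g i + bregman (regularizer η) z y with hF
  have hFeq : ∀ z, F z = lin z + regularizer η z := by
    intro z
    simp only [hF, hlin, bregman]
    ring
  obtain ⟨M, hM⟩ := (isCompact_stdSimplex ℝ (Fin K)).bddBelow_image hlinc.continuousOn
  have hM' : ∀ z ∈ simplex K, M ≤ lin z := fun z hz =>
    hM ⟨z, ⟨fun i => (hz.1 i).le, hz.2⟩, rfl⟩
  set N : ℝ := η * (F y - M) + K ^ 2 with hN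
  set C : Set (Fin K → ℝ) := stdSimplex ℝ (Fin K) ∩ {z | ∀ i, Real.exp (-N) ≤ z i} with hC
  have hCs : C ⊆ simplex K := fun z hz =>
    ⟨fun i => (Real.exp_pos _).trans_le (hz.2 i), hz.1.2⟩
  have hmem : ∀ z ∈ simplex K, F z ≤ F y → z ∈ C := by
    intro z hz hle
    refine ⟨⟨fun i => (hz.1 i).le, hz.2⟩, fun i => ?_⟩
    have h1 := regularizer_ge hη hz i
    have h2 := hM' z hz
    rw [hFeq z] at hle
    have h3 : 1 / η * (Real.log (1 / z i) - K ^ 2) ≤ F y - M := by linarith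
    rw [one_div_mul_eq_div, div_le_iff₀ hη, one_div, Real.log_inv] at h3
    rw [← Real.le_log_iff_exp_le (hz.1 i)]
    linarith
  have hCcl : IsClosed {z : Fin K → ℝ | ∀ i, Real.exp (-N) ≤ z i} := by
    simp only [Set.ofPred_forall]
    exact isClosed_iInter fun i => isClosed_le continuous_const (continuous_apply i)
  have hCc : IsCompact C := (isCompact_stdSimplex ℝ (Fin K)).inter_right hCcl
  have hFc : ContinuousOn F C := by
    intro z hz
    have h1 : ContinuousAt F z := by
      have h2 := (hasFDerivAt_regularizer η (hCs hz).1).continuousAt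
      have : F = fun z => lin z + regularizer η z := funext hFeq
      rw [this]
      exact hlinc.continuousAt.add h2
    exact h1.continuousWithinAt
  obtain ⟨x, hxC, hx⟩ := hCc.exists_isMinOn ⟨y, hmem y hy le_rfl⟩ hFc
  refine ⟨x, hCs hxC, fun z hz => ?_⟩
  by_cases h : F z ≤ F y
  · exact hx (hmem z hz h)
  · exact (hx (hmem y hy le_rfl)).trans (not_le.1 h).le

/-- `x` satisfies the first-order optimality condition of the mirror descent step from `y` along
the loss vector `g`: the Lagrange multiplier of the constraint `∑ x_i = 1`, computed from any
coordinate, is the same. -/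
structure IsProx {K : ℕ} (η : ℝ) (g y x : Fin K → ℝ) : Prop where
  mem_left : y ∈ simplex K
  mem_right : x ∈ simplex K
  eq : ∀ i j, mirrorMap K (x i) - mirrorMap K (y i) + η * g i =
    mirrorMap K (x j) - mirrorMap K (y j) + η * g j

theorem isProx_mdUpdate {K : ℕ} {η : ℝ} (hη : 0 < η) (g : Fin K → ℝ) {y : Fin K → ℝ}
    (hy : y ∈ simplex K) : IsProx η g y (mdUpdate η g y) := by
  obtain ⟨hx, hmin⟩ := Classical.epsilon_spec (exists_isMinOn_simplex hη g hy)
  change mdUpdate η g y ∈ simplex K at hx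
  change IsMinOn _ _ (mdUpdate η g y) at hmin
  set x := mdUpdate η g y with hxdef
  refine ⟨hy, hx, fun i j => ?_⟩
  rcases eq_or_ne i j with rfl | hij
  · rfl
  set v : Fin K → ℝ := Pi.single i 1 - Pi.single j 1 with hv
  have hvsum : ∑ k, v k = 0 := by simp [hv, Finset.sum_sub_distrib]
  have hline : HasDerivAt (fun s : ℝ => x + s • v) v 0 := by
    simpa using ((hasDerivAt_id (0 : ℝ)).smul_const v).const_add x
  have hreg := hasFDerivAt_regularizer η hx.1
  have hF : HasFDerivAt (fun z => ∑ k, z k * g k + bregman (regularizer η) z y)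
      ((∑ k, g k • (ContinuousLinearMap.proj k : (Fin K → ℝ) →L[ℝ] ℝ)) +
        ((∑ k, (1 / η * (mirrorMap K (x k) + K)) •
          (ContinuousLinearMap.proj k : (Fin K → ℝ) →L[ℝ] ℝ)) -
          fderiv ℝ (regularizer η) y)) x := by
    refine HasFDerivAt.add ?_ ?_
    · refine HasFDerivAt.fun_sum fun k _ => ?_
      have hk : HasFDerivAt (fun z : Fin K → ℝ => z k)
        (ContinuousLinearMap.proj k : (Fin K → ℝ) →L[ℝ] ℝ) x := hasFDerivAt_apply k x
      exact hk.mul_const (g k)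
    · unfold bregman
      refine (hreg.sub_const (regularizer η y)).sub ?_
      exact (fderiv ℝ (regularizer η) y).hasFDerivAt.comp x ((hasFDerivAt_id x).sub_const y)
  have hd := hF.comp_hasDerivAt_of_eq (0 : ℝ) hline (by simp)
  have hloc : IsLocalMin
      ((fun z => ∑ k, z k * g k + bregman (regularizer η) z y) ∘ fun s : ℝ => x + s • v) 0 := by
    have hpos : ∀ᶠ s : ℝ in nhds 0, ∀ k, 0 < (x + s • v) k := by
      rw [Filter.eventually_all]
      intro k
      have hc : Continuous fun s : ℝ => (x + s • v) k := by
        simp only [Pi.add_apply, Pi.smul_apply, smul_eq_mul]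
        fun_prop
      exact hc.continuousAt.eventually (lt_mem_nhds (by simpa using hx.1 k))
    filter_upwards [hpos] with s hs
    have hmem : x + s • v ∈ simplex K := by
      refine ⟨hs, ?_⟩
      simp only [Pi.add_apply, Pi.smul_apply, smul_eq_mul, Finset.sum_add_distrib,
        ← Finset.mul_sum, hvsum, hx.2]
      ring
    simpa using hmin hmem
  have h0 := hloc.hasDerivAt_eq_zero hd
  rw [(hasFDerivAt_regularizer η hy.1).fderiv] at h0
  simp [hv, Pi.single_apply, mul_sub, Finset.sum_sub_distrib] at h0
  have hη' := hη.ne'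
  field_simp at h0
  linarith

theorem IsProx.trans {K : ℕ} {η : ℝ} {g g' y x x' : Fin K → ℝ} (h : IsProx η g y x)
    (h' : IsProx η g' y x') : IsProx η (fun i => g' i - g i) x x' :=
  ⟨h.mem_right, h'.mem_right, fun i j => by
    have h1 := h.eq i j
    have h2 := h'.eq i j
    linarith⟩

/-- The mirror map, seen modulo constants, determines a point of the simplex. -/
theorem simplex_ext {K : ℕ} {x y : Fin K → ℝ} (hx : x ∈ simplex K) (hy : y ∈ simplex K)
    (h : ∀ i j, mirrorMap K (x i) - mirrorMap K (x j) = mirrorMap K (y i) - mirrorMap K (y j)) :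
    x = y := by
  have key : ∀ {x y : Fin K → ℝ}, x ∈ simplex K → y ∈ simplex K →
      (∀ i j, mirrorMap K (x i) - mirrorMap K (x j) = mirrorMap K (y i) - mirrorMap K (y j)) →
      ∀ i, ¬ x i < y i := by
    intro x y hx hy h i hi
    have hall : ∀ j, x j < y j := by
      intro j
      have h1 := mirrorMap_strictMonoOn K (hx.1 i) (hy.1 i) hi
      have h2 : mirrorMap K (x j) < mirrorMap K (y j) := by linarith [h i j]
      exact ((mirrorMap_strictMonoOn K).lt_iff_lt (hx.1 j) (hy.1 j)).1 h2
    have := Finset.sum_lt_sum_of_nonempty (s := Finset.univ) ⟨i, Finset.mem_univ i⟩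
      fun j _ => hall j
    rw [hx.2, hy.2] at this
    exact lt_irrefl _ this
  funext i
  exact le_antisymm (not_lt.1 (key hy hx (fun i j => (h i j).symm) i)) (not_lt.1 (key hx hy h i))

theorem measurableSet_simplex (K : ℕ) : MeasurableSet (simplex K) := by
  have h : simplex K = (⋂ i, {x | 0 < x i}) ∩ {x | ∑ i, x i = 1} := by
    ext x
    simp [simplex]
  rw [h]
  refine MeasurableSet.inter ?_ ?_
  · exact MeasurableSet.iInter fun i => measurableSet_lt measurable_const (measurable_pi_apply i)
  · exact measurableSet_eq_fun (Finset.measurable_sum _ fun i _ => measurable_pi_apply i)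
      measurable_const

theorem measurable_mirrorMap (K : ℕ) : Measurable (mirrorMap K) := by
  unfold mirrorMap
  fun_prop

/-- The minimizer depends measurably on the data. The optimality condition expresses an injective
measurable function of the minimizer through the data, and an injective measurable map between
standard Borel spaces has a measurable inverse (Lusin–Souslin). -/
theorem measurable_of_isProx {K : ℕ} {η : ℝ} {Ω : Type*} [MeasurableSpace Ω]
    {g y x : Ω → Fin K → ℝ} (hg : Measurable g) (hy : Measurable y)
    (h : ∀ ω, IsProx η (g ω) (y ω) (x ω)) : Measurable x := by
  let Ψ : simplex K → Fin K → Fin K → ℝ := fun z i j =>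
    mirrorMap K (z.1 i) - mirrorMap K (z.1 j)
  have hΨm : Measurable Ψ := by
    refine measurable_pi_lambda _ fun i => measurable_pi_lambda _ fun j => ?_
    exact ((measurable_mirrorMap K).comp ((measurable_pi_apply i).comp measurable_subtype_coe)).sub
      ((measurable_mirrorMap K).comp ((measurable_pi_apply j).comp measurable_subtype_coe))
  have hΨi : Function.Injective Ψ := by
    intro z z' hz
    exact Subtype.ext (simplex_ext z.2 z'.2 fun i j => congrFun (congrFun hz i) j)
  have : StandardBorelSpace (simplex K) := (measurableSet_simplex K).standardBorel
  have hemb : MeasurableEmbedding Ψ := hΨm.measurableEmbedding hΨi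
  let f : Ω → simplex K := fun ω => ⟨x ω, (h ω).mem_right⟩
  have hf : Measurable f := by
    rw [← hemb.measurable_comp_iff]
    have : Ψ ∘ f = fun ω i j => (mirrorMap K (y ω i) - η * g ω i) -
        (mirrorMap K (y ω j) - η * g ω j) := by
      funext ω i j
      have := (h ω).eq i j
      change mirrorMap K (x ω i) - mirrorMap K (x ω j) = _
      linarith
    rw [this]
    refine measurable_pi_lambda _ fun i => measurable_pi_lambda _ fun j => ?_
    have e : ∀ i, Measurable fun ω => mirrorMap K (y ω i) - η * g ω i := fun i =>
      ((measurable_mirrorMap K).comp ((measurable_pi_apply i).comp hy)).sub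
        (((measurable_pi_apply i).comp hg).const_mul η)
    exact (e i).sub (e j)
  exact measurable_subtype_coe.comp hf

/-! ### Stability of mirror descent steps -/

theorem coordDiv_mul_sq (K : ℕ) {v x : ℝ} (hv : 0 < v) (hx : 0 < x) :
    coordDiv K (v ^ 2 * x) x = (v ^ 2 - 1 - 2 * Real.log v) +
      K * x * (2 * v ^ 2 * Real.log v - v ^ 2 + 1) := by
  unfold coordDiv mirrorMap
  rw [Real.log_mul (by positivity) hx.ne', Real.log_pow]
  field_simp
  push_cast
  ring

/-- The bound uses `ln v ≤ v - 1` and `ln v ≥ 1 - 1 / v` at `v = √(z / x)`. -/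
theorem coordDiv_ge (K : ℕ) {v x : ℝ} (hv : 0 < v) (hx : 0 < x) :
    (1 + K * x) * (v - 1) ^ 2 ≤ coordDiv K (v ^ 2 * x) x := by
  rw [coordDiv_mul_sq K hv hx]
  have h1 := Real.log_le_sub_one_of_pos hv
  have h2 := Real.one_sub_inv_le_log_of_pos hv
  have h3 : v ^ 2 * (1 - v⁻¹) ≤ v ^ 2 * Real.log v := by gcongr
  have h4 : v ^ 2 * (1 - v⁻¹) = v ^ 2 - v := by field_simp
  have h5 : 0 ≤ K * x := by positivity
  have h6 : K * x * (v - 1) ^ 2 ≤ K * x * (2 * v ^ 2 * Real.log v - v ^ 2 + 1) := by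
    gcongr
    nlinarith
  nlinarith

theorem exists_sq_mul {x z : ℝ} (hx : 0 < x) (hz : 0 < z) : ∃ v, 0 < v ∧ z = v ^ 2 * x :=
  ⟨√(z / x), Real.sqrt_pos.2 (by positivity), by
    rw [Real.sq_sqrt (by positivity)]
    field_simp⟩

theorem coordDiv_nonneg (K : ℕ) {x z : ℝ} (hx : 0 < x) (hz : 0 < z) : 0 ≤ coordDiv K z x := by
  obtain ⟨v, hv, rfl⟩ := exists_sq_mul hx hz
  exact le_trans (by positivity) (coordDiv_ge K hv hx)

theorem stability_le (K : ℕ) {η x z g : ℝ} (hη : 0 < η) (hη1 : η ≤ 1 / 162) (hx : 0 < x)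
    (hz : 0 < z) (hg : |x * g| ≤ 2) :
    (x - z) * g - 1 / η * coordDiv K z x ≤ 2 * η * (x * g) ^ 2 / (1 + K * x) := by
  obtain ⟨v, hv, rfl⟩ := exists_sq_mul hx hz
  have hd := coordDiv_ge K hv hx
  have hA : 1 ≤ 1 + K * x := by
    have : 0 ≤ K * x := by positivity
    linarith
  set A := 1 + K * x
  set B := A / (2 * η) with hB
  have hB1 : 81 ≤ B := by
    rw [hB, le_div_iff₀ (by positivity)]
    linarith
  have h1 : 2 * B * (v - 1) ^ 2 ≤ 1 / η * coordDiv K (v ^ 2 * x) x := by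
    have : 2 * B * (v - 1) ^ 2 = 1 / η * (A * (v - 1) ^ 2) := by
      rw [hB]
      field_simp
    rw [this]
    gcongr
  have h2 : 2 * η * (x * g) ^ 2 / A = (x * g) ^ 2 / B := by
    rw [hB]
    field_simp
  have h3 : (x - v ^ 2 * x) * g = -((v - 1) ^ 2 + 2 * (v - 1)) * (x * g) := by ring
  rw [h2, h3, le_div_iff₀ (by linarith)]
  set G := x * g
  set e := v - 1
  have hG := (abs_le.1 hg).1
  have h4 : 0 ≤ e ^ 2 * (B + G) * B := by
    have : 0 ≤ B + G := by linarith
    have : 0 ≤ B := by linarith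
    positivity
  have h5 : 2 * B * e ^ 2 * B ≤ 1 / η * coordDiv K (v ^ 2 * x) x * B := by
    have : 0 ≤ B := by linarith
    gcongr
  nlinarith [sq_nonneg (B * e + G)]

theorem le_three_halves_mul_of_mirrorMap {K : ℕ} {x y c : ℝ} (hy : 0 < y)
    (h : mirrorMap K x - mirrorMap K y ≤ c) (hc : c * y ≤ 1 / 4) : x ≤ 3 / 2 * y := by
  by_contra! hlt
  have h1 := one_div_sub_one_div_le (K := K) hy (show y ≤ x by linarith)
  have h2 : 1 / x < 1 / (3 / 2 * y) := one_div_lt_one_div_of_lt (by positivity) hlt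
  have h3 : 1 / (3 / 2 * y) = 2 / 3 * (1 / y) := by field_simp
  have h4 : 1 / 3 * (1 / y) < c := by linarith
  have h5 : 1 / 3 * (1 / y) * y < c * y := by gcongr
  have h6 : 1 / 3 * (1 / y) * y = 1 / 3 := by field_simp
  linarith

theorem half_le_of_mirrorMap {K : ℕ} {x y c : ℝ} (hx : 0 < x) (hy : 0 < y)
    (h : mirrorMap K y - mirrorMap K x ≤ c) (hc : c * y ≤ 1 / 4) : y / 2 ≤ x := by
  by_contra! hlt
  have h1 := one_div_sub_one_div_le (K := K) hx (show x ≤ y by linarith)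
  have h2 : 1 / (y / 2) < 1 / x := one_div_lt_one_div_of_lt hx hlt
  have h3 : 1 / (y / 2) = 2 * (1 / y) := by field_simp
  have h4 : 1 / y < c := by linarith
  have h5 : 1 / y * y < c * y := by gcongr
  have h6 : 1 / y * y = 1 := by field_simp
  linarith

theorem exists_le_of_simplex {K : ℕ} {x y : Fin K → ℝ} (hx : x ∈ simplex K) (hy : y ∈ simplex K)
    (hK : 0 < K) : ∃ i, x i ≤ y i := by
  have : Nonempty (Fin K) := ⟨⟨0, hK⟩⟩
  obtain ⟨i, -, hi⟩ := Finset.exists_le_of_sum_le (s := Finset.univ) (f := x) (g := y)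
    Finset.univ_nonempty (by rw [hx.2, hy.2])
  exact ⟨i, hi⟩

theorem IsProx.ratio_of_bounded {K : ℕ} {η : ℝ} {m y x : Fin K → ℝ} (h : IsProx η m y x)
    (hη : 0 < η) (hη1 : η ≤ 1 / 162) (hm : ∀ i, m i ∈ Set.Icc (0 : ℝ) 1) (i : Fin K) :
    y i / 2 ≤ x i ∧ x i ≤ 2 * y i := by
  have hK : 0 < K := i.pos
  obtain ⟨p, hp⟩ := exists_le_of_simplex h.mem_right h.mem_left hK
  obtain ⟨q, hq⟩ := exists_le_of_simplex h.mem_left h.mem_right hK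
  have hp' := (mirrorMap_strictMonoOn K).monotoneOn (h.mem_right.1 p) (h.mem_left.1 p) hp
  have hq' := (mirrorMap_strictMonoOn K).monotoneOn (h.mem_left.1 q) (h.mem_right.1 q) hq
  have e1 := h.eq i p
  have e2 := h.eq i q
  have b : ∀ j, 0 ≤ η * m j ∧ η * m j ≤ η := fun j =>
    ⟨mul_nonneg hη.le (hm j).1, by nlinarith [(hm j).2]⟩
  have hy1 := simplex_le_one h.mem_left i
  have hy0 := h.mem_left.1 i
  have hc : η * y i ≤ 1 / 4 := by nlinarith
  constructor
  · refine half_le_of_mirrorMap (K := K) (c := η) (h.mem_right.1 i) hy0 ?_ hc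
    linarith [b i, b p, b q]
  · have := le_three_halves_mul_of_mirrorMap (K := K) (c := η) (x := x i) hy0 (by linarith [b i, b p, b q]) hc
    linarith

/-- A step along a loss supported on the single arm `k` changes every coordinate by at most a
factor of `2`. For arms larger than `x k` this follows from the total mass moved, for the other
arms from the size of the Lagrange multiplier. -/
theorem IsProx.ratio_of_single {K : ℕ} {η : ℝ} {d y x : Fin K → ℝ} (h : IsProx η d y x)
    (hη : 0 < η) (hη1 : η ≤ 1 / 162) (k : Fin K) (hd : ∀ j, j ≠ k → d j = 0)
    (hk : |y k * d k| ≤ 2) (i : Fin K) : y i / 2 ≤ x i ∧ x i ≤ 2 * y i := by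
  have hK : 0 < K := i.pos
  obtain ⟨p, hp⟩ := exists_le_of_simplex h.mem_right h.mem_left hK
  obtain ⟨q, hq⟩ := exists_le_of_simplex h.mem_left h.mem_right hK
  have mono := mirrorMap_strictMonoOn K
  have hp' := mono.monotoneOn (h.mem_right.1 p) (h.mem_left.1 p) hp
  have hq' := mono.monotoneOn (h.mem_left.1 q) (h.mem_right.1 q) hq
  have hyk := h.mem_left.1 k
  have hxk := h.mem_right.1 k
  have hyi := h.mem_left.1 i
  have hxi := h.mem_right.1 i
  obtain ⟨hk1, hk2⟩ := abs_le.1 hk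
  have hsum : ∑ j ∈ univ.erase k, (x j - y j) = y k - x k := by
    have h1 := Finset.add_sum_erase univ x (Finset.mem_univ k)
    have h2 := Finset.add_sum_erase univ y (Finset.mem_univ k)
    rw [h.mem_right.2] at h1
    rw [h.mem_left.2] at h2
    rw [Finset.sum_sub_distrib]
    linarith
  have ek := h.eq i k
  have ep := h.eq k p
  have eq := h.eq k q
  have dval : ∀ j, η * d j = 0 ∨ η * d j = η * d k := by
    intro j
    by_cases hj : j = k
    · right; rw [hj]
    · left; rw [hd j hj, mul_zero]
  rcases le_total 0 (d k) with hs | hs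
  · have hsη : 0 ≤ η * d k := mul_nonneg hη.le hs
    have hlam0 : mirrorMap K (y k) - mirrorMap K (x k) ≤ η * d k := by
      rcases dval q with h0 | h0 <;> linarith
    have hlam1 : mirrorMap K (x k) ≤ mirrorMap K (y k) := by
      rcases dval p with h0 | h0 <;> linarith
    have hxyk : x k ≤ y k := (mono.le_iff_le hxk hyk).1 hlam1
    have hhalf : y k / 2 ≤ x k := half_le_of_mirrorMap (K := K) hxk hyk hlam0 (by nlinarith)
    by_cases hik : i = k
    · subst hik
      exact ⟨hhalf, by linarith⟩
    have hup : ∀ j, j ≠ k → y j ≤ x j := by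
      intro j hj
      have e := h.eq j k
      rw [hd j hj] at e
      exact (mono.le_iff_le (h.mem_left.1 j) (h.mem_right.1 j)).1 (by linarith)
    refine ⟨by linarith [hup i hik], ?_⟩
    rcases le_total (y k) (y i) with hle | hle
    · have hi : x i - y i ≤ ∑ j ∈ univ.erase k, (x j - y j) :=
        Finset.single_le_sum (f := fun j => x j - y j)
          (fun j hj => by linarith [hup j (Finset.ne_of_mem_erase hj)])
          (Finset.mem_erase.2 ⟨hik, Finset.mem_univ i⟩)
      linarith
    · rw [hd i hik] at ek
      have := le_three_halves_mul_of_mirrorMap (K := K) (c := η * d k) (x := x i) hyi (by linarith) (by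
        nlinarith)
      linarith
  · have hsη : η * d k ≤ 0 := mul_nonpos_of_nonneg_of_nonpos hη.le hs
    have hlam0 : mirrorMap K (x k) - mirrorMap K (y k) ≤ -(η * d k) := by
      rcases dval p with h0 | h0 <;> linarith
    have hlam1 : mirrorMap K (y k) ≤ mirrorMap K (x k) := by
      rcases dval q with h0 | h0 <;> linarith
    have hxyk : y k ≤ x k := (mono.le_iff_le hyk hxk).1 hlam1
    have hhalf : x k ≤ 3 / 2 * y k := le_three_halves_mul_of_mirrorMap (K := K) hyk hlam0 (by nlinarith)
    by_cases hik : i = k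
    · subst hik
      exact ⟨by linarith, by linarith⟩
    have hup : ∀ j, j ≠ k → x j ≤ y j := by
      intro j hj
      have e := h.eq j k
      rw [hd j hj] at e
      exact (mono.le_iff_le (h.mem_right.1 j) (h.mem_left.1 j)).1 (by linarith)
    refine ⟨?_, by linarith [hup i hik]⟩
    rcases le_total (y k) (y i) with hle | hle
    · have hi : y i - x i ≤ ∑ j ∈ univ.erase k, (y j - x j) :=
        Finset.single_le_sum (f := fun j => y j - x j)
          (fun j hj => by linarith [hup j (Finset.ne_of_mem_erase hj)])
          (Finset.mem_erase.2 ⟨hik, Finset.mem_univ i⟩)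
      have e2 : ∑ j ∈ univ.erase k, (y j - x j) = -∑ j ∈ univ.erase k, (x j - y j) := by
        rw [← Finset.sum_neg_distrib]
        exact Finset.sum_congr rfl fun j _ => by ring
      linarith
    · rw [hd i hik] at ek
      exact half_le_of_mirrorMap (K := K) (c := -(η * d k)) hxi hyi (by linarith) (by nlinarith)

/-- The three-point identity for Bregman divergences at the optimum of a mirror descent step. -/
theorem IsProx.three_point {K : ℕ} {η : ℝ} {g y x u : Fin K → ℝ} (h : IsProx η g y x)
    (hη : 0 < η) (hu : u ∈ simplex K) :
    ∑ i, (x i - u i) * g i =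
      1 / η * (∑ i, coordDiv K (u i) (y i) - ∑ i, coordDiv K (u i) (x i) -
        ∑ i, coordDiv K (x i) (y i)) := by
  have hK : 0 < K := by
    rcases Nat.eq_zero_or_pos K with rfl | h0
    · exact absurd hu.2 (by simp)
    · exact h0
  set i₀ : Fin K := ⟨0, hK⟩
  set lam := mirrorMap K (x i₀) - mirrorMap K (y i₀) + η * g i₀
  have h1 : ∀ i, coordDiv K (u i) (y i) - coordDiv K (u i) (x i) - coordDiv K (x i) (y i) =
      η * ((x i - u i) * g i) - lam * (x i - u i) := by
    intro i
    have e := h.eq i i₀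
    have e' : η * g i = lam - (mirrorMap K (x i) - mirrorMap K (y i)) := by linarith
    have e'' : η * ((x i - u i) * g i) = (x i - u i) * (η * g i) := by ring
    rw [e'', e']
    unfold coordDiv
    ring
  rw [← Finset.sum_sub_distrib, ← Finset.sum_sub_distrib, Finset.sum_congr rfl fun i _ => h1 i,
    Finset.sum_sub_distrib, ← Finset.mul_sum, ← Finset.mul_sum]
  have h2 : ∑ i, (x i - u i) = 0 := by rw [Finset.sum_sub_distrib, h.mem_right.2, hu.2, sub_self]
  rw [h2]
  field_simp
  ring

/-! ### The bias towards the last minority arm -/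

/-- The distribution `x` with an `a`-fraction of the mass of `S \ {k}` moved to `k`. -/
def biased {K : ℕ} (S : Finset (Fin K)) (k : Fin K) (a : ℝ) (x : Fin K → ℝ) (i : Fin K) : ℝ :=
  if i ∈ S \ {k} then x i * (1 - a)
  else if i = k then x i + a * ∑ j ∈ S \ {k}, x j
  else x i

section Biased

variable {K : ℕ} (S : Finset (Fin K)) (k : Fin K) {b : ℝ} {x : Fin K → ℝ}

theorem biased_of_mem {a : ℝ} {j : Fin K} (hj : j ∈ S \ {k}) :
    biased S k a x j = x j * (1 - a) := by
  rw [biased, if_pos hj]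

theorem biased_self {a : ℝ} : biased S k a x k = x k + a * ∑ j ∈ S \ {k}, x j := by
  rw [biased, if_neg (by simp), if_pos rfl]

theorem mul_eq_mul_biased (hb : 0 ≤ b) {j : Fin K} (hj : j ∈ S \ {k}) :
    b / (1 + b) * x j = b * biased S k (b / (1 + b)) x j := by
  rw [biased_of_mem S k hj]
  field_simp
  ring

theorem le_mul_biased (hb : 0 ≤ b) (hx : ∀ i, 0 < x i) (i : Fin K) :
    x i ≤ (1 + b) * biased S k (b / (1 + b)) x i := by
  have h0 := hx i
  unfold biased
  split_ifs with h1 h2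
  · apply le_of_eq
    field_simp
    ring
  · have h3 : 0 ≤ b / (1 + b) * ∑ j ∈ S \ {k}, x j :=
      mul_nonneg (by positivity) (Finset.sum_nonneg fun j _ => (hx j).le)
    nlinarith
  · nlinarith

theorem biased_pos (hb : 0 ≤ b) (hx : ∀ i, 0 < x i) (i : Fin K) :
    0 < biased S k (b / (1 + b)) x i := by
  have h1 := le_mul_biased S k hb hx i
  have h2 := hx i
  by_contra! h3
  nlinarith

theorem sum_biased_mul (a : ℝ) (f : Fin K → ℝ) :
    ∑ i, biased S k a x i * f i = ∑ i, x i * f i + ∑ j ∈ S \ {k}, a * x j * (f k - f j) := by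
  have h1 : ∀ i, biased S k a x i * f i = x i * f i +
      ((if i = k then (a * ∑ j ∈ S \ {k}, x j) * f k else 0) -
        if i ∈ S \ {k} then a * x i * f i else 0) := by
    intro i
    unfold biased
    by_cases h2 : i ∈ S \ {k}
    · have h3 : i ≠ k := by
        rintro rfl
        simp at h2
      rw [if_pos h2, if_pos h2, if_neg h3]
      ring
    · rw [if_neg h2, if_neg h2]
      by_cases h3 : i = k
      · subst h3
        simp only [if_true]
        ring
      · simp [h3]
  rw [Finset.sum_congr rfl fun i _ => h1 i, Finset.sum_add_distrib, Finset.sum_sub_distrib]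
  simp only [Finset.sum_ite_eq', Finset.mem_univ, if_true, Finset.sum_ite_mem, Finset.univ_inter,
    mul_sub, Finset.sum_sub_distrib, Finset.mul_sum, Finset.sum_mul]

theorem sum_biased (a : ℝ) : ∑ i, biased S k a x i = ∑ i, x i := by
  have := sum_biased_mul (x := x) S k a fun _ => 1
  simpa using this

/-- The bias replaces the loss of the minority arm that is drawn, with weight `b`, by the loss
of the arm `k`. -/
theorem sum_biased_sub (hb : 0 ≤ b) (f : Fin K → ℝ) :
    ∑ i, biased S k (b / (1 + b)) x i * f i - ∑ i, x i * f i =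
      ∑ j ∈ S, biased S k (b / (1 + b)) x j * (b * (f k - f j)) := by
  rw [sum_biased_mul, add_sub_cancel_left]
  have h1 : ∑ j ∈ S \ {k}, b / (1 + b) * x j * (f k - f j) =
      ∑ j ∈ S \ {k}, biased S k (b / (1 + b)) x j * (b * (f k - f j)) := by
    refine Finset.sum_congr rfl fun j hj => ?_
    rw [mul_eq_mul_biased S k hb hj]
    ring
  rw [h1]
  refine Finset.sum_subset Finset.sdiff_subset fun j hj hj' => ?_
  have : j = k := by
    by_contra h
    exact hj' (by simp [hj, h])
  rw [this]
  ring

theorem sum_biased_le (hb : 0 ≤ b) (hx : ∀ i, 0 < x i) {h : Fin K → ℝ} (hh : ∀ i, 0 ≤ h i) :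
    ∑ j ∈ S, biased S k (b / (1 + b)) x j * h j ≤
      ∑ j, (if j ∈ S then x j else 0) * h j +
        b * (∑ j ∈ S, biased S k (b / (1 + b)) x j) * h k := by
  have hpos := biased_pos S k hb hx
  have e1 : ∑ j, (if j ∈ S then x j else 0) * h j = ∑ j ∈ S, x j * h j := by
    simp [ite_mul, Finset.sum_ite_mem]
  rw [e1]
  have h1 : ∑ j ∈ S \ {k}, biased S k (b / (1 + b)) x j * h j ≤ ∑ j ∈ S \ {k}, x j * h j := by
    refine Finset.sum_le_sum fun j hj => mul_le_mul_of_nonneg_right ?_ (hh j)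
    rw [biased_of_mem S k hj]
    have : 0 ≤ b / (1 + b) := by positivity
    nlinarith [hx j]
  have h2 : b / (1 + b) * ∑ j ∈ S \ {k}, x j ≤
      b * ∑ j ∈ S, biased S k (b / (1 + b)) x j := by
    rw [Finset.mul_sum, Finset.sum_congr rfl fun j hj => mul_eq_mul_biased S k hb hj,
      ← Finset.mul_sum]
    gcongr
    · exact fun j _ _ => (hpos j).le
    · exact Finset.sdiff_subset
  by_cases hk : k ∈ S
  · rw [← Finset.sum_sdiff (Finset.singleton_subset_iff.2 hk), ← Finset.sum_sdiff
      (Finset.singleton_subset_iff.2 hk) (f := fun j => x j * h j), Finset.sum_singleton,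
      Finset.sum_singleton, biased_self]
    have := mul_le_mul_of_nonneg_right h2 (hh k)
    linarith
  · rw [Finset.sdiff_singleton_eq_erase, Finset.erase_eq_of_notMem hk] at h1
    have : 0 ≤ b * (∑ j ∈ S, biased S k (b / (1 + b)) x j) * h k :=
      mul_nonneg (mul_nonneg hb (Finset.sum_nonneg fun j _ => (hpos j).le)) (hh k)
    linarith

end Biased

/-! ### The run of the algorithm on a fixed loss sequence -/

/-- The state after `t` rounds with parameter `α = 8η`, when the arms `a` are played against the
loss vectors `ℓ`. -/
def run {K : ℕ} (η β : ℝ) (a : ℕ → Fin K) (ℓ : ℕ → Fin K → ℝ) (t : ℕ) : State K :=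
  state η (8 * η) β a (fun s => ℓ s (a s)) t

/-- The importance-weighted loss estimate of a round in which arm `k` is played and the loss `c`
observed. -/
def lossEst {K : ℕ} (s : State K) (k : Fin K) (c : ℝ) (i : Fin K) : ℝ :=
  (if k = i then (c - s.m i) / s.w i else 0) + s.m i

/-- The bias parameter `α (1 - c_τ)`; the algorithm moves the fraction `b / (1 + b)`. -/
def biasOf {K : ℕ} (η : ℝ) (a : ℕ → Fin K) (ℓ : ℕ → Fin K → ℝ) (s : State K) : ℝ :=
  8 * η * (1 - ℓ s.τ (a s.τ))

section Run

variable {K : ℕ} {η β : ℝ} {a : ℕ → Fin K} {ℓ : ℕ → Fin K → ℝ} {T : ℕ}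

theorem run_zero : run η β a ℓ 0 = State.init K := rfl

theorem run_succ_τ (t : ℕ) : (run η β a ℓ (t + 1)).τ =
    if a (t + 1) ∈ (run η β a ℓ t).S then t + 1 else (run η β a ℓ t).τ := rfl

theorem run_succ_S (t : ℕ) : (run η β a ℓ (t + 1)).S =
    Finset.univ.filter fun i => (run η β a ℓ t).x i < β := by
  unfold run
  rw [state, State.step]

theorem mem_run_succ_S (t : ℕ) (i : Fin K) :
    i ∈ (run η β a ℓ (t + 1)).S ↔ (run η β a ℓ t).x i < β := by
  simp [run_succ_S]

theorem run_succ_m (t : ℕ) (i : Fin K) : (run η β a ℓ (t + 1)).m i =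
    if i ∈ (run η β a ℓ (t + 1)).S then
      ℓ (run η β a ℓ (t + 1)).τ (a (run η β a ℓ (t + 1)).τ)
    else if lastRound a i (t + 1) = 0 then 0
    else ℓ (lastRound a i (t + 1)) (a (lastRound a i (t + 1))) := rfl

theorem run_succ_x' (t : ℕ) : (run η β a ℓ (t + 1)).x' =
    mdUpdate η (lossEst (run η β a ℓ t) (a (t + 1)) (ℓ (t + 1) (a (t + 1))))
      (run η β a ℓ t).x' := rfl

theorem run_succ_x (t : ℕ) : (run η β a ℓ (t + 1)).x =
    mdUpdate η (run η β a ℓ (t + 1)).m (run η β a ℓ (t + 1)).x' := rfl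

theorem run_succ_w (t : ℕ) : (run η β a ℓ (t + 1)).w =
    biased (run η β a ℓ (t + 1)).S (a (run η β a ℓ (t + 1)).τ)
      (biasOf η a ℓ (run η β a ℓ (t + 1)) / (1 + biasOf η a ℓ (run η β a ℓ (t + 1))))
      (run η β a ℓ (t + 1)).x := by
  funext i
  unfold run biasOf biased
  rfl

theorem run_τ_mem {t : ℕ} (ht : 1 ≤ t) :
    1 ≤ (run η β a ℓ t).τ ∧ (run η β a ℓ t).τ ≤ t := by
  obtain ⟨t, rfl⟩ : ∃ n, t = n + 1 := ⟨t - 1, by omega⟩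
  have h := (state_τ_isGreatest η (8 * η) β a (fun s => ℓ s (a s)) t).1
  exact ⟨h.1, h.2.1⟩

/-- The properties of a state that hold after every round. -/
structure State.Good {K : ℕ} (η : ℝ) (s : State K) : Prop where
  m_mem : ∀ i, s.m i ∈ Set.Icc (0 : ℝ) 1
  prox : IsProx η s.m s.x' s.x
  w_pos : ∀ i, 0 < s.w i
  w_sum : ∑ i, s.w i = 1
  x_le : ∀ i, s.x i ≤ 11 / 10 * s.w i

theorem State.Good.w_le_one {s : State K} (h : s.Good η) (i : Fin K) : s.w i ≤ 1 :=
  simplex_le_one ⟨h.w_pos, h.w_sum⟩ i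

theorem State.Good.abs_sub_le {s : State K} (h : s.Good η) {i : Fin K} {c : ℝ}
    (hc : c ∈ Set.Icc (0 : ℝ) 1) : |c - s.m i| ≤ 1 := by
  have := h.m_mem i
  rw [abs_le]
  constructor <;> linarith [this.1, this.2, hc.1, hc.2]

theorem lastRound_eq {i : Fin K} {t : ℕ} (h : lastRound a i t ≠ 0) : a (lastRound a i t) = i :=
  Nat.findGreatest_of_ne_zero (P := fun s => a s = i) rfl h

theorem lastRound_le (i : Fin K) (t : ℕ) : lastRound a i t ≤ t := Nat.findGreatest_le t

theorem lastRound_succ (i : Fin K) (t : ℕ) :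
    lastRound a i (t + 1) = if a (t + 1) = i then t + 1 else lastRound a i t :=
  Nat.findGreatest_succ _

/-- The range of the learning rate, and losses in `[0, 1]` in rounds `1, …, T`. -/
structure Admissible {K : ℕ} (η : ℝ) (T : ℕ) (ℓ : ℕ → Fin K → ℝ) : Prop where
  pos : 0 < η
  le : η ≤ 1 / 162
  loss_mem : ∀ t ∈ Finset.Icc 1 T, ∀ i, ℓ t i ∈ Set.Icc (0 : ℝ) 1

theorem Admissible.mem (h : Admissible η T ℓ) {t : ℕ} (ht : 1 ≤ t) (htT : t ≤ T) (i : Fin K) :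
    ℓ t i ∈ Set.Icc (0 : ℝ) 1 := h.loss_mem t (Finset.mem_Icc.2 ⟨ht, htT⟩) i

theorem Admissible.stored_mem (h : Admissible η T ℓ) {t : ℕ} (ht : 1 ≤ t) (htT : t ≤ T)
    (i : Fin K) : ℓ (run η β a ℓ t).τ i ∈ Set.Icc (0 : ℝ) 1 := by
  have hτ := run_τ_mem (η := η) (β := β) (a := a) (ℓ := ℓ) ht
  exact h.mem hτ.1 (by omega) i

theorem biasOf_mem (h : Admissible η T ℓ) {t : ℕ} (ht : 1 ≤ t) (htT : t ≤ T) :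
    0 ≤ biasOf η a ℓ (run η β a ℓ t) ∧ biasOf η a ℓ (run η β a ℓ t) ≤ 8 * η := by
  have h1 := h.stored_mem (β := β) (a := a) ht htT (a (run η β a ℓ t).τ)
  have h2 := h.pos
  unfold biasOf
  exact ⟨mul_nonneg (by positivity) (by linarith [h1.2]), by nlinarith [h1.1]⟩

theorem State.Good.abs_mul_lossEst_sub {s : State K} (h : s.Good η) (k : Fin K) (c : ℝ) :
    |s.x k * (lossEst s k c k - s.m k)| ≤ 11 / 10 * |c - s.m k| := by
  have hw := h.w_pos k
  have hx := h.prox.mem_right.1 k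
  have e : s.x k * (lossEst s k c k - s.m k) = s.x k / s.w k * (c - s.m k) := by
    simp only [lossEst, if_true]
    ring
  rw [e, abs_mul, abs_of_pos (by positivity)]
  refine mul_le_mul_of_nonneg_right ?_ (abs_nonneg _)
  rw [div_le_iff₀ hw]
  exact h.x_le k

theorem lossEst_of_ne {s : State K} {k : Fin K} {c : ℝ} {j : Fin K} (hj : j ≠ k) :
    lossEst s k c j - s.m j = 0 := by
  simp [lossEst, hj.symm]

theorem init_good (hK : 0 < K) : (State.init K).Good η := by
  have hK' : (0 : ℝ) < K := by exact_mod_cast hK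
  have hs : (fun _ : Fin K => 1 / (K : ℝ)) ∈ simplex K :=
    ⟨fun _ => by positivity, by simp [hK'.ne']⟩
  refine ⟨fun i => by simp [State.init], ⟨hs, hs, fun i j => by simp [State.init]⟩, hs.1, hs.2,
    fun i => ?_⟩
  have : 0 < 1 / (K : ℝ) := by positivity
  simp only [State.init]
  linarith

theorem run_good (h : Admissible η T ℓ) {t : ℕ} (ht : t ≤ T) : (run η β a ℓ t).Good η := by
  induction t with
  | zero => exact init_good (a 0).pos
  | succ t ih =>
    have ih := ih (by omega)
    have hb := biasOf_mem (β := β) (a := a) h (Nat.le_add_left 1 t) ht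
    have hx' : (run η β a ℓ (t + 1)).x' ∈ simplex K := by
      rw [run_succ_x']
      exact (isProx_mdUpdate h.pos _ ih.prox.mem_left).mem_right
    have hprox : IsProx η (run η β a ℓ (t + 1)).m (run η β a ℓ (t + 1)).x'
        (run η β a ℓ (t + 1)).x := by
      rw [run_succ_x]
      exact isProx_mdUpdate h.pos _ hx'
    refine ⟨fun i => ?_, hprox, fun i => ?_, ?_, fun i => ?_⟩
    · rw [run_succ_m]
      split_ifs with h1 h2
      · exact h.stored_mem (by omega) ht _
      · simp
      · have := lastRound_le (a := a) i (t + 1)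
        exact h.mem (by omega) (by omega) _
    · rw [run_succ_w]
      exact biased_pos _ _ hb.1 hprox.mem_right.1 i
    · rw [run_succ_w, sum_biased]
      exact hprox.mem_right.2
    · rw [run_succ_w]
      refine (le_mul_biased (run η β a ℓ (t + 1)).S (a (run η β a ℓ (t + 1)).τ) hb.1
        hprox.mem_right.1 i).trans ?_
      refine mul_le_mul_of_nonneg_right ?_ (biased_pos _ _ hb.1 hprox.mem_right.1 i).le
      linarith [hb.2, h.le]

theorem run_prox (h : Admissible η T ℓ) {t : ℕ} (ht : t < T) :
    IsProx η (lossEst (run η β a ℓ t) (a (t + 1)) (ℓ (t + 1) (a (t + 1))))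
      (run η β a ℓ t).x' (run η β a ℓ (t + 1)).x' := by
  rw [run_succ_x']
  exact isProx_mdUpdate h.pos _ (run_good h ht.le).prox.mem_left

theorem run_ratio (h : Admissible η T ℓ) {t : ℕ} (ht : t < T) (i : Fin K) :
    (run η β a ℓ t).x i / 4 ≤ (run η β a ℓ (t + 1)).x i ∧
      (run η β a ℓ (t + 1)).x i ≤ 4 * (run η β a ℓ t).x i := by
  have hg := run_good (β := β) (a := a) h ht.le
  have hg' := run_good (β := β) (a := a) h (Nat.succ_le_of_lt ht)
  have h1 := hg'.prox.ratio_of_bounded h.pos h.le hg'.m_mem i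
  have h2 := (hg.prox.trans (run_prox h ht)).ratio_of_single h.pos h.le (a (t + 1))
    (fun j hj => lossEst_of_ne hj) (by
      have := hg.abs_mul_lossEst_sub (a (t + 1)) (ℓ (t + 1) (a (t + 1)))
      have := hg.abs_sub_le (i := a (t + 1)) (h.mem (by omega) ht (a (t + 1)))
      linarith) i
  constructor <;> linarith [h1.1, h1.2, h2.1, h2.2]

theorem run_x_ge (h : Admissible η T ℓ) {t : ℕ} (ht : t ≤ T) (i : Fin K) :
    1 / K * (1 / 4) ^ t ≤ (run η β a ℓ t).x i := by
  induction t with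
  | zero => simp [run_zero, State.init]
  | succ t ih =>
    have h1 := ih (by omega)
    have h2 := (run_ratio (β := β) (a := a) h (Nat.lt_of_succ_le ht) i).1
    rw [pow_succ]
    linarith

/-- One round of optimistic mirror descent: the potential `∑ coordDiv (u i) (x' i)` pays for the
estimated regret up to a second-order term in the prediction error at the arm played. -/
theorem omd_round (h : Admissible η T ℓ) {t : ℕ} (ht : t < T) {u : Fin K → ℝ}
    (hu : u ∈ simplex K) :
    ∑ i, ((run η β a ℓ t).x i - u i) *
        lossEst (run η β a ℓ t) (a (t + 1)) (ℓ (t + 1) (a (t + 1))) i ≤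
      1 / η * (∑ i, coordDiv K (u i) ((run η β a ℓ t).x' i) -
        ∑ i, coordDiv K (u i) ((run η β a ℓ (t + 1)).x' i)) +
      3 * η * (ℓ (t + 1) (a (t + 1)) - (run η β a ℓ t).m (a (t + 1))) ^ 2 /
        (1 + K * (run η β a ℓ t).x (a (t + 1))) := by
  have hg := run_good (β := β) (a := a) h ht.le
  have hp := run_prox (β := β) (a := a) h ht
  set k := a (t + 1)
  set c := ℓ (t + 1) k
  set s := run η β a ℓ t
  set s' := run η β a ℓ (t + 1)
  set e := lossEst s k c
  have hη := h.pos
  have h3 := hp.three_point hη hu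
  have h4 := hg.prox.three_point hη hp.mem_right
  have hnn : 0 ≤ 1 / η * ∑ i, coordDiv K (s.x i) (s.x' i) :=
    mul_nonneg (by positivity) (Finset.sum_nonneg fun i _ =>
      coordDiv_nonneg K (hg.prox.mem_left.1 i) (hg.prox.mem_right.1 i))
  have hk1 := hg.abs_mul_lossEst_sub k c
  have hk2 := hg.abs_sub_le (i := k) (h.mem (by omega) ht k)
  have hst := stability_le K (g := e k - s.m k) hη h.le (hg.prox.mem_right.1 k)
    (hp.mem_right.1 k) (hk1.trans (by linarith))
  have hdec : ∑ i, (s.x i - u i) * e i = ∑ i, (s.x i - s'.x' i) * (e i - s.m i) +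
      ∑ i, (s.x i - s'.x' i) * s.m i + ∑ i, (s'.x' i - u i) * e i := by
    rw [← Finset.sum_add_distrib, ← Finset.sum_add_distrib]
    exact Finset.sum_congr rfl fun i _ => by ring
  have hone : ∑ i, (s.x i - s'.x' i) * (e i - s.m i) =
      (s.x k - s'.x' k) * (e k - s.m k) := by
    refine Finset.sum_eq_single k (fun j _ hj => ?_) (fun hk => absurd (Finset.mem_univ k) hk)
    rw [lossEst_of_ne hj, mul_zero]
  have hD : coordDiv K (s'.x' k) (s.x k) ≤ ∑ i, coordDiv K (s'.x' i) (s.x i) :=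
    Finset.single_le_sum (f := fun i => coordDiv K (s'.x' i) (s.x i))
      (fun i _ => coordDiv_nonneg K (hg.prox.mem_right.1 i) (hp.mem_right.1 i))
      (Finset.mem_univ k)
  have hD' : 1 / η * coordDiv K (s'.x' k) (s.x k) ≤
      1 / η * ∑ i, coordDiv K (s'.x' i) (s.x i) := by gcongr
  have hsq : (s.x k * (e k - s.m k)) ^ 2 ≤ 3 / 2 * (c - s.m k) ^ 2 := by
    rw [← sq_abs (s.x k * _), ← sq_abs (c - s.m k)]
    have h0 := abs_nonneg (s.x k * (e k - s.m k))
    have h1 := abs_nonneg (c - s.m k)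
    nlinarith
  have hfin : 2 * η * (s.x k * (e k - s.m k)) ^ 2 / (1 + K * s.x k) ≤
      3 * η * (c - s.m k) ^ 2 / (1 + K * s.x k) := by
    have := hg.prox.mem_right.1 k
    have h0 : 0 < 1 + K * s.x k := by positivity
    rw [div_le_div_iff_of_pos_right h0]
    nlinarith
  have h4' : ∑ i, (s.x i - s'.x' i) * s.m i = 1 / η * (∑ i, coordDiv K (s'.x' i) (s.x' i) -
      ∑ i, coordDiv K (s'.x' i) (s.x i) - ∑ i, coordDiv K (s.x i) (s.x' i)) := h4
  rw [hdec, hone, h4', h3]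
  linarith

end Run

/-! ### Path length and variation between plays -/

/-- The amount by which the loss of arm `i` changes from round `t - 1` to round `t`, where the loss
of round `0` is `0`. -/
def lossChange {K : ℕ} (ℓ : ℕ → Fin K → ℝ) (t : ℕ) (i : Fin K) : ℝ :=
  |ℓ t i - if t = 1 then 0 else ℓ (t - 1) i|

/-- The variation of the loss of arm `i` since it was last played, up to round `n`. -/
def sinceLast {K : ℕ} (a : ℕ → Fin K) (ℓ : ℕ → Fin K → ℝ) (i : Fin K) (n : ℕ) : ℝ :=
  ∑ s ∈ Finset.Ioc (lastRound a i n) n, lossChange ℓ s i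

section Variation

variable {K : ℕ} (a : ℕ → Fin K) (ℓ : ℕ → Fin K → ℝ)

theorem lossChange_nonneg (t : ℕ) (i : Fin K) : 0 ≤ lossChange ℓ t i := abs_nonneg _

theorem sinceLast_nonneg (i : Fin K) (n : ℕ) : 0 ≤ sinceLast a ℓ i n :=
  Finset.sum_nonneg fun s _ => lossChange_nonneg ℓ s i

theorem abs_sub_le_sum_lossChange (i : Fin K) {r n : ℕ} (hn : 1 ≤ n) (hrn : r ≤ n) :
    |ℓ n i - if r = 0 then 0 else ℓ r i| ≤ ∑ s ∈ Finset.Ioc r n, lossChange ℓ s i := by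
  induction n, hn using Nat.le_induction with
  | base =>
    interval_cases r
    · simp [lossChange]
    · simp
  | succ n hn ih =>
    rcases Nat.lt_or_ge n r with h | h
    · have : r = n + 1 := by omega
      subst this
      simp
    · have h1 := ih h
      have h2 : lossChange ℓ (n + 1) i = |ℓ (n + 1) i - ℓ n i| := by
        rw [lossChange, if_neg (by omega), Nat.add_sub_cancel]
      rw [Finset.sum_Ioc_succ_top h, h2]
      refine (abs_sub_le _ (ℓ n i) _).trans ?_
      linarith

theorem sinceLast_succ (i : Fin K) (n : ℕ) : sinceLast a ℓ i (n + 1) =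
    if a (n + 1) = i then 0 else sinceLast a ℓ i n + lossChange ℓ (n + 1) i := by
  unfold sinceLast
  rw [lastRound_succ]
  split_ifs with h
  · simp
  · rw [Finset.sum_Ioc_succ_top (lastRound_le i n)]

/-- Charging the variation of an arm since its last play to the round of its next play costs at
most the path length, as the intervals between plays are disjoint. -/
theorem sum_sinceLast_le (n : ℕ) :
    ∑ t ∈ Finset.range n, (sinceLast a ℓ (a (t + 1)) t + lossChange ℓ (t + 1) (a (t + 1))) ≤
      ∑ t ∈ Finset.Icc 1 n, ∑ i, lossChange ℓ t i := by
  have key : ∑ t ∈ Finset.range n,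
      (sinceLast a ℓ (a (t + 1)) t + lossChange ℓ (t + 1) (a (t + 1))) +
      ∑ i, sinceLast a ℓ i n = ∑ t ∈ Finset.Icc 1 n, ∑ i, lossChange ℓ t i := by
    induction n with
    | zero => simp [sinceLast]
    | succ n ih =>
      rw [Finset.sum_range_succ, Finset.sum_Icc_succ_top (by omega), ← ih]
      have h1 : ∀ i, sinceLast a ℓ i (n + 1) = (sinceLast a ℓ i n + lossChange ℓ (n + 1) i) -
          if a (n + 1) = i then sinceLast a ℓ i n + lossChange ℓ (n + 1) i else 0 := by
        intro i
        rw [sinceLast_succ]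
        split_ifs <;> ring
      rw [Finset.sum_congr rfl fun i _ => h1 i, Finset.sum_sub_distrib]
      simp only [Finset.sum_add_distrib, Finset.sum_ite_eq, Finset.mem_univ, if_true]
      ring
  have : 0 ≤ ∑ i, sinceLast a ℓ i n := Finset.sum_nonneg fun i _ => sinceLast_nonneg a ℓ i n
  linarith

end Variation

/-! ### Regret on a fixed play sequence -/

/-- The deviation of `G k` from its mean under the weights `w`; it has conditional mean `0` if `k`
is drawn from `w`. -/
def deviation {K : ℕ} (w G : Fin K → ℝ) (k : Fin K) : ℝ := G k - ∑ j, w j * G j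

/-- The function of the arm drawn in round `t + 1` whose mean under the sampling distribution `w`
is the comparator's loss plus `⟨x - u, m⟩`: it corrects the observed loss by the loss estimate and
by the bias. In the first round there is no bias. -/
def correctedLoss {K : ℕ} (η β : ℝ) (a : ℕ → Fin K) (ℓ : ℕ → Fin K → ℝ) (u : Fin K → ℝ) (t : ℕ)
    (j : Fin K) : ℝ :=
  ℓ (t + 1) j -
    ((run η β a ℓ t).x j - u j) * (ℓ (t + 1) j - (run η β a ℓ t).m j) / (run η β a ℓ t).w j -
    if t ≠ 0 ∧ j ∈ (run η β a ℓ t).S then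
      biasOf η a ℓ (run η β a ℓ t) * (ℓ (t + 1) (a (run η β a ℓ t).τ) - ℓ (t + 1) j) else 0

/-- If an arm of the minority group is drawn in round `t + 1`, the change of the loss of the last
minority arm since it was played. -/
def switchCost {K : ℕ} (η β : ℝ) (a : ℕ → Fin K) (ℓ : ℕ → Fin K → ℝ) (t : ℕ) : ℝ :=
  if a (t + 1) ∈ (run η β a ℓ t).S then
    |ℓ (t + 1) (a (run η β a ℓ t).τ) - ℓ (run η β a ℓ t).τ (a (run η β a ℓ t).τ)| else 0

/-- A potential that telescopes along the minority rounds: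
`(1 - c) (c - c') = (c - c ^ 2 / 2) - (c' - c' ^ 2 / 2) - (c' - c) ^ 2 / 2`. -/
def storedPotential {K : ℕ} (η β : ℝ) (a : ℕ → Fin K) (ℓ : ℕ → Fin K → ℝ) (t : ℕ) : ℝ :=
  ℓ (run η β a ℓ t).τ (a (run η β a ℓ t).τ) - ℓ (run η β a ℓ t).τ (a (run η β a ℓ t).τ) ^ 2 / 2

section Pathwise

variable {K : ℕ} {η β : ℝ} {a : ℕ → Fin K} {ℓ : ℕ → Fin K → ℝ} {T : ℕ}

/-- The bias acts as if the loss of the minority arm drawn were replaced, with weight `biasOf`, by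
that of the last minority arm. -/
theorem mean_bias (h : Admissible η T ℓ) {t : ℕ} (ht : t ≤ T) (f : Fin K → ℝ) :
    ∑ j, (run η β a ℓ t).w j * (if t ≠ 0 ∧ j ∈ (run η β a ℓ t).S then
      biasOf η a ℓ (run η β a ℓ t) * (f (a (run η β a ℓ t).τ) - f j) else 0) =
    ∑ j, (run η β a ℓ t).w j * f j - ∑ j, (run η β a ℓ t).x j * f j := by
  rcases Nat.eq_zero_or_pos t with rfl | h0
  · simp [run_zero, State.init]
  · obtain ⟨n, rfl⟩ : ∃ n, t = n + 1 := ⟨t - 1, by omega⟩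
    have hb := biasOf_mem (β := β) (a := a) h h0 ht
    rw [run_succ_w, sum_biased_sub _ _ hb.1]
    simp [mul_ite, Finset.sum_ite_mem]

/-- The observed loss, decomposed into a deviation with conditional mean `0`, the loss of the
comparator, the estimated regret and the effect of the bias. -/
theorem loss_eq (h : Admissible η T ℓ) {t : ℕ} (ht : t < T) (u : Fin K → ℝ) :
    ℓ (t + 1) (a (t + 1)) =
      deviation (run η β a ℓ t).w (correctedLoss η β a ℓ u t) (a (t + 1)) +
      ∑ i, u i * ℓ (t + 1) i +
      ∑ i, ((run η β a ℓ t).x i - u i) *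
        lossEst (run η β a ℓ t) (a (t + 1)) (ℓ (t + 1) (a (t + 1))) i +
      if t ≠ 0 ∧ a (t + 1) ∈ (run η β a ℓ t).S then
        biasOf η a ℓ (run η β a ℓ t) *
          (ℓ (t + 1) (a (run η β a ℓ t).τ) - ℓ (t + 1) (a (t + 1))) else 0 := by
  have hg := run_good (β := β) (a := a) h ht.le
  have hmb := mean_bias (β := β) (a := a) h ht.le (ℓ (t + 1))
  set s := run η β a ℓ t
  have e1 : ∑ j, s.w j * correctedLoss η β a ℓ u t j =
      ∑ j, u j * ℓ (t + 1) j + ∑ j, (s.x j - u j) * s.m j := by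
    have e2 : ∀ j, s.w j * correctedLoss η β a ℓ u t j = s.w j * ℓ (t + 1) j -
        (s.x j - u j) * (ℓ (t + 1) j - s.m j) - s.w j * (if t ≠ 0 ∧ j ∈ s.S then
          biasOf η a ℓ s * (ℓ (t + 1) (a s.τ) - ℓ (t + 1) j) else 0) := by
      intro j
      have hw := (hg.w_pos j).ne'
      change s.w j * (ℓ (t + 1) j - (s.x j - u j) * (ℓ (t + 1) j - s.m j) / s.w j - _) = _
      rw [mul_sub, mul_sub, mul_div_cancel₀ _ hw]
    rw [Finset.sum_congr rfl fun j _ => e2 j, Finset.sum_sub_distrib, hmb,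
      Finset.sum_sub_distrib, ← Finset.sum_add_distrib, sub_sub_sub_cancel_left,
      ← Finset.sum_sub_distrib]
    exact Finset.sum_congr rfl fun j _ => by ring
  have e3 : ∑ i, (s.x i - u i) * lossEst s (a (t + 1)) (ℓ (t + 1) (a (t + 1))) i =
      (s.x (a (t + 1)) - u (a (t + 1))) * (ℓ (t + 1) (a (t + 1)) - s.m (a (t + 1))) /
        s.w (a (t + 1)) + ∑ j, (s.x j - u j) * s.m j := by
    simp only [lossEst, mul_add, mul_ite, mul_zero, Finset.sum_add_distrib, Finset.sum_ite_eq,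
      Finset.mem_univ, if_true]
    ring
  rw [deviation, e1, e3, correctedLoss]
  ring

theorem storedPotential_mem (h : Admissible η T ℓ) {t : ℕ} (ht : 1 ≤ t) (htT : t ≤ T) :
    storedPotential η β a ℓ t ∈ Set.Icc (0 : ℝ) (1 / 2) := by
  have h1 := h.stored_mem (β := β) (a := a) ht htT (a (run η β a ℓ t).τ)
  unfold storedPotential
  constructor <;> nlinarith [h1.1, h1.2]

/-- For a majority arm the prediction error is at most the variation since the arm was last
played, and the entropy part of the regularizer gains the factor `1 / (1 + K x) ≤ 4 / (K β)`. -/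
theorem majority_error_le (h : Admissible η T ℓ) (hβ : 0 < β) {t : ℕ} (ht0 : 1 ≤ t) (ht : t < T)
    {k : Fin K} (hk : k ∉ (run η β a ℓ t).S) :
    3 * η * (ℓ (t + 1) k - (run η β a ℓ t).m k) ^ 2 / (1 + K * (run η β a ℓ t).x k) ≤
      12 * η / (K * β) * (sinceLast a ℓ k t + lossChange ℓ (t + 1) k) := by
  obtain ⟨n, rfl⟩ : ∃ n, t = n + 1 := ⟨t - 1, by omega⟩
  have hη := h.pos
  have hK : (0 : ℝ) < K := by exact_mod_cast k.pos
  have hg := run_good (β := β) (a := a) h ht.le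
  have hx : β / 4 ≤ (run η β a ℓ (n + 1)).x k := by
    rw [mem_run_succ_S, not_lt] at hk
    have := (run_ratio (β := β) (a := a) h (Nat.lt_of_succ_lt ht) k).1
    linarith
  have habs := hg.abs_sub_le (i := k) (h.mem (Nat.le_add_left 1 (n + 1)) ht k)
  have hle : |ℓ (n + 1 + 1) k - (run η β a ℓ (n + 1)).m k| ≤
      sinceLast a ℓ k (n + 1) + lossChange ℓ (n + 1 + 1) k := by
    have hl := lastRound_le (a := a) k (n + 1)
    have h1 := abs_sub_le_sum_lossChange ℓ k (r := lastRound a k (n + 1)) (n := n + 1 + 1)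
      (by omega) (by omega)
    rw [Finset.sum_Ioc_succ_top hl] at h1
    have h2 : (run η β a ℓ (n + 1)).m k =
        if lastRound a k (n + 1) = 0 then 0 else ℓ (lastRound a k (n + 1)) k := by
      rw [run_succ_m, if_neg hk]
      split_ifs with h0
      · rfl
      · rw [lastRound_eq h0]
    rw [h2]
    exact h1
  set d := ℓ (n + 1 + 1) k - (run η β a ℓ (n + 1)).m k
  set U := sinceLast a ℓ k (n + 1) + lossChange ℓ (n + 1 + 1) k
  set x := (run η β a ℓ (n + 1)).x k
  have hsq : d ^ 2 ≤ U := by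
    rw [← sq_abs]
    nlinarith [abs_nonneg d]
  have hxp : 0 < x := by linarith
  have hU : 0 ≤ U := (sq_nonneg d).trans hsq
  calc 3 * η * d ^ 2 / (1 + K * x) ≤ 3 * η * U / (K * β / 4) := by
        apply div_le_div₀ (by positivity) (by gcongr) (by positivity)
        nlinarith
    _ = 12 * η / (K * β) * U := by
        field_simp
        ring

/-- The bias effect and the prediction error of a minority round together telescope, up to the
change of the loss of the last minority arm. Here `c` is the stored loss, `c'` the observed loss,
and `c''` the current loss of the last minority arm. -/
theorem minority_error_le {η c c' c'' q : ℝ} (hη : 0 ≤ η) (hc : c ∈ Set.Icc (0 : ℝ) 1)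
    (hq : 1 ≤ q) :
    8 * η * (1 - c) * (c'' - c') + 3 * η * (c' - c) ^ 2 / q ≤
      8 * η * ((c - c ^ 2 / 2) - (c' - c' ^ 2 / 2)) + 8 * η * |c'' - c| := by
  have h1 : 3 * η * (c' - c) ^ 2 / q ≤ 3 * η * (c' - c) ^ 2 := div_le_self (by positivity) hq
  have h2 : (1 - c) * (c'' - c) ≤ |c'' - c| := by
    have h3 := le_abs_self (c'' - c)
    have h4 := abs_nonneg (c'' - c)
    have h5 : (1 - c) * (c'' - c) ≤ (1 - c) * |c'' - c| :=
      mul_le_mul_of_nonneg_left h3 (by linarith [hc.2])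
    nlinarith [hc.1]
  have h6 : 8 * η * ((1 - c) * (c'' - c)) ≤ 8 * η * |c'' - c| := by gcongr
  nlinarith [mul_nonneg hη (sq_nonneg (c' - c))]

theorem round_loss_le (h : Admissible η T ℓ) (hβ : 0 < β) {t : ℕ} (ht0 : 1 ≤ t) (ht : t < T)
    {u : Fin K → ℝ} (hu : u ∈ simplex K) :
    ℓ (t + 1) (a (t + 1)) ≤
      deviation (run η β a ℓ t).w (correctedLoss η β a ℓ u t) (a (t + 1)) +
      ∑ i, u i * ℓ (t + 1) i +
      1 / η * (∑ i, coordDiv K (u i) ((run η β a ℓ t).x' i) -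
        ∑ i, coordDiv K (u i) ((run η β a ℓ (t + 1)).x' i)) +
      8 * η * (storedPotential η β a ℓ t - storedPotential η β a ℓ (t + 1)) +
      8 * η * switchCost η β a ℓ t +
      12 * η / (K * β) * (sinceLast a ℓ (a (t + 1)) t + lossChange ℓ (t + 1) (a (t + 1))) := by
  have hη := h.pos
  have homd := omd_round (β := β) (a := a) h ht hu
  have heq := loss_eq (β := β) (a := a) h ht u
  have hg := run_good (β := β) (a := a) h ht.le
  have hU : 0 ≤ 12 * η / (K * β) *
      (sinceLast a ℓ (a (t + 1)) t + lossChange ℓ (t + 1) (a (t + 1))) := by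
    have h1 := sinceLast_nonneg a ℓ (a (t + 1)) t
    have h2 := lossChange_nonneg ℓ (t + 1) (a (t + 1))
    positivity
  by_cases hk : a (t + 1) ∈ (run η β a ℓ t).S
  · rw [if_pos ⟨by omega, hk⟩] at heq
    have hm : (run η β a ℓ t).m (a (t + 1)) =
        ℓ (run η β a ℓ t).τ (a (run η β a ℓ t).τ) := by
      obtain ⟨n, rfl⟩ : ∃ n, t = n + 1 := ⟨t - 1, by omega⟩
      rw [run_succ_m, if_pos hk]
    have hx := hg.prox.mem_right.1 (a (t + 1))
    have hq : 1 ≤ 1 + K * (run η β a ℓ t).x (a (t + 1)) := by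
      have : 0 ≤ K * (run η β a ℓ t).x (a (t + 1)) := by positivity
      linarith
    have hmin := minority_error_le (c' := ℓ (t + 1) (a (t + 1)))
      (c'' := ℓ (t + 1) (a (run η β a ℓ t).τ)) hη.le
      (h.stored_mem (β := β) (a := a) ht0 ht.le (a (run η β a ℓ t).τ)) hq
    have hp : storedPotential η β a ℓ (t + 1) =
        ℓ (t + 1) (a (t + 1)) - ℓ (t + 1) (a (t + 1)) ^ 2 / 2 := by
      rw [storedPotential, run_succ_τ, if_pos hk]
    rw [hm] at homd
    rw [hp, storedPotential, switchCost, if_pos hk]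
    rw [biasOf] at heq
    linarith
  · rw [if_neg (by simp [hk])] at heq
    have hmaj := majority_error_le h hβ ht0 ht hk
    have hp : storedPotential η β a ℓ (t + 1) = storedPotential η β a ℓ t := by
      rw [storedPotential, run_succ_τ, if_neg hk, storedPotential]
    rw [hp, switchCost, if_neg hk]
    linarith

theorem first_round_loss_le (h : Admissible η T ℓ) (hT : 0 < T)
    {u : Fin K → ℝ} (hu : u ∈ simplex K) :
    ℓ 1 (a 1) ≤
      deviation (run η β a ℓ 0).w (correctedLoss η β a ℓ u 0) (a 1) + ∑ i, u i * ℓ 1 i +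
      1 / η * (∑ i, coordDiv K (u i) ((run η β a ℓ 0).x' i) -
        ∑ i, coordDiv K (u i) ((run η β a ℓ 1).x' i)) + 3 * η := by
  have hη := h.pos
  have homd := omd_round (β := β) (a := a) h hT hu
  have heq := loss_eq (β := β) (a := a) h hT u
  have hg := run_good (β := β) (a := a) h hT.le
  rw [if_neg (by simp)] at heq
  have habs := hg.abs_sub_le (i := a (0 + 1)) (h.mem (Nat.le_add_left 1 0) hT (a (0 + 1)))
  have hx := hg.prox.mem_right.1 (a (0 + 1))
  have hq : 1 ≤ 1 + K * (run η β a ℓ 0).x (a (0 + 1)) := by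
    have : 0 ≤ K * (run η β a ℓ 0).x (a (0 + 1)) := by positivity
    linarith
  have h1 : 3 * η * (ℓ (0 + 1) (a (0 + 1)) - (run η β a ℓ 0).m (a (0 + 1))) ^ 2 /
        (1 + K * (run η β a ℓ 0).x (a (0 + 1))) ≤ 3 * η := by
    refine (div_le_self (by positivity) hq).trans ?_
    rw [← sq_abs]
    have : |ℓ (0 + 1) (a (0 + 1)) - (run η β a ℓ 0).m (a (0 + 1))| ^ 2 ≤ 1 :=
      pow_le_one₀ (abs_nonneg _) habs
    nlinarith
  rw [zero_add] at heq homd h1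
  linarith

/-- The loss on a fixed path against a comparator `u` in the interior of the simplex, up to
deviations and the switching cost. -/
theorem sum_loss_le (h : Admissible η T ℓ) (hβ : 0 < β) (hT : 1 ≤ T)
    {u : Fin K → ℝ} (hu : u ∈ simplex K) :
    ∑ t ∈ Finset.range T, ℓ (t + 1) (a (t + 1)) ≤
      ∑ t ∈ Finset.range T,
        deviation (run η β a ℓ t).w (correctedLoss η β a ℓ u t) (a (t + 1)) +
      ∑ t ∈ Finset.range T, ∑ i, u i * ℓ (t + 1) i +
      1 / η * ∑ i, coordDiv K (u i) (1 / K) + 7 * η +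
      8 * η * ∑ t ∈ Finset.Ico 1 T, switchCost η β a ℓ t +
      12 * η / (K * β) * ∑ t ∈ Finset.Icc 1 T, ∑ i, lossChange ℓ t i := by
  have hη := h.pos
  have hU : ∀ t, 0 ≤ 12 * η / (K * β) *
      (sinceLast a ℓ (a (t + 1)) t + lossChange ℓ (t + 1) (a (t + 1))) := by
    intro t
    have h1 := sinceLast_nonneg a ℓ (a (t + 1)) t
    have h2 := lossChange_nonneg ℓ (t + 1) (a (t + 1))
    positivity
  have key : ∀ n, 1 ≤ n → n ≤ T → ∑ t ∈ Finset.range n, ℓ (t + 1) (a (t + 1)) ≤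
      ∑ t ∈ Finset.range n,
        deviation (run η β a ℓ t).w (correctedLoss η β a ℓ u t) (a (t + 1)) +
      ∑ t ∈ Finset.range n, ∑ i, u i * ℓ (t + 1) i +
      1 / η * (∑ i, coordDiv K (u i) ((run η β a ℓ 0).x' i) -
        ∑ i, coordDiv K (u i) ((run η β a ℓ n).x' i)) + 3 * η +
      8 * η * (storedPotential η β a ℓ 1 - storedPotential η β a ℓ n) +
      8 * η * ∑ t ∈ Finset.Ico 1 n, switchCost η β a ℓ t +
      12 * η / (K * β) * ∑ t ∈ Finset.range n,
        (sinceLast a ℓ (a (t + 1)) t + lossChange ℓ (t + 1) (a (t + 1))) := by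
    intro n hn
    induction n, hn using Nat.le_induction with
    | base =>
      intro _
      have h1 := first_round_loss_le (β := β) (a := a) h (by omega) hu
      simp only [Finset.sum_range_one, Finset.Ico_self, Finset.sum_empty, zero_add]
      have h2 := hU 0
      rw [zero_add] at h2
      linarith
    | succ n hn ih =>
      intro hnT
      have h1 := round_loss_le (a := a) h hβ hn (Nat.lt_of_succ_le hnT) hu
      have h2 := ih (by omega)
      rw [Finset.sum_range_succ, Finset.sum_range_succ, Finset.sum_range_succ,
        Finset.sum_range_succ, Finset.sum_Ico_succ_top hn]
      linarith
  have h1 := key T hT le_rfl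
  have h2 := (storedPotential_mem (β := β) (a := a) h le_rfl hT).2
  have h3 := (storedPotential_mem (β := β) (a := a) h hT le_rfl).1
  have h4 : 0 ≤ 1 / η * ∑ i, coordDiv K (u i) ((run η β a ℓ T).x' i) :=
    mul_nonneg (by positivity) (Finset.sum_nonneg fun i _ =>
      coordDiv_nonneg K ((run_good h le_rfl).prox.mem_left.1 i) (hu.1 i))
  have h5 : 12 * η / (K * β) * ∑ t ∈ Finset.range T,
        (sinceLast a ℓ (a (t + 1)) t + lossChange ℓ (t + 1) (a (t + 1))) ≤
      12 * η / (K * β) * ∑ t ∈ Finset.Icc 1 T, ∑ i, lossChange ℓ t i := by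
    gcongr
    exact sum_sinceLast_le a ℓ T
  have h6 : ∑ i, coordDiv K (u i) ((run η β a ℓ 0).x' i) = ∑ i, coordDiv K (u i) (1 / K) := rfl
  rw [h6] at h1
  nlinarith

theorem switchCost_le_one (h : Admissible η T ℓ) {t : ℕ} (ht0 : 1 ≤ t) (ht : t < T) :
    switchCost η β a ℓ t ≤ 1 := by
  unfold switchCost
  split_ifs
  · have h1 := h.mem (Nat.le_add_left 1 t) ht (a (run η β a ℓ t).τ)
    have h2 := h.stored_mem (β := β) (a := a) ht0 ht.le (a (run η β a ℓ t).τ)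
    rw [abs_le]
    constructor <;> linarith [h1.1, h1.2, h2.1, h2.2]
  · exact zero_le_one

theorem switchCost_nonneg (t : ℕ) : 0 ≤ switchCost η β a ℓ t := by
  unfold switchCost
  split_ifs
  · exact abs_nonneg _
  · exact le_rfl

/-! ### The cost of switching between minority arms -/

/-- The variation of the loss of arm `i` over the block of `L` consecutive rounds that contains
round `n`. -/
def blockVariation (L T : ℕ) (ℓ : ℕ → Fin K → ℝ) (n : ℕ) (i : Fin K) : ℝ :=
  ∑ s ∈ (Finset.Icc 1 T).filter (fun s => s / L = n / L), lossChange ℓ s i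

/-- The block variation, cut off at the largest possible loss difference `1`. -/
def cutVariation (L T : ℕ) (ℓ : ℕ → Fin K → ℝ) (n : ℕ) (i : Fin K) : ℝ :=
  min 1 (blockVariation L T ℓ n i)

/-- The function of the arm drawn in round `t + 1` whose deviations enter the bound on the switching
cost. -/
def switchWeight (η β : ℝ) (L T : ℕ) (a : ℕ → Fin K) (ℓ : ℕ → Fin K → ℝ) (t : ℕ) (j : Fin K) : ℝ :=
  if j ∈ (run η β a ℓ t).S then
    cutVariation L T ℓ (t + 1) j -
      8 * η * cutVariation L T ℓ (t + 1) (a (run η β a ℓ t).τ) else 0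

theorem blockVariation_nonneg (L n : ℕ) (i : Fin K) : 0 ≤ blockVariation L T ℓ n i :=
  Finset.sum_nonneg fun s _ => lossChange_nonneg ℓ s i

theorem cutVariation_mem (L n : ℕ) (i : Fin K) : cutVariation L T ℓ n i ∈ Set.Icc (0 : ℝ) 1 :=
  ⟨le_min zero_le_one (blockVariation_nonneg L n i), min_le_left _ _⟩

theorem sum_blockVariation_le {L : ℕ} (hL : 1 ≤ L) :
    ∑ n ∈ Finset.Icc 1 T, ∑ i, blockVariation L T ℓ n i ≤
      L * ∑ t ∈ Finset.Icc 1 T, ∑ i, lossChange ℓ t i := by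
  rw [Finset.sum_comm, Finset.sum_comm (s := Finset.Icc 1 T) (t := Finset.univ), Finset.mul_sum]
  refine Finset.sum_le_sum fun i _ => ?_
  simp only [blockVariation, Finset.sum_filter]
  rw [Finset.sum_comm, Finset.mul_sum]
  refine Finset.sum_le_sum fun s _ => ?_
  rw [← Finset.sum_filter, Finset.sum_const, nsmul_eq_mul]
  refine mul_le_mul_of_nonneg_right ?_ (lossChange_nonneg ℓ s i)
  have hsub : (Finset.Icc 1 T).filter (fun n => s / L = n / L) ⊆
      Finset.Ico (L * (s / L)) (L * (s / L) + L) := by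
    intro n hn
    have hn' := (Finset.mem_filter.1 hn).2
    rw [Finset.mem_Ico, hn']
    have h1 := Nat.div_add_mod n L
    have h2 := Nat.mod_lt n (show L > 0 by omega)
    constructor <;> omega
  have := Finset.card_le_card hsub
  rw [Nat.card_Ico] at this
  exact_mod_cast this.trans (by omega)

theorem abs_sub_le_cutVariation (h : Admissible η T ℓ) {L r n : ℕ} (hr : 1 ≤ r) (hrn : r ≤ n)
    (hn : n ≤ T) (hb : r / L = n / L) (i : Fin K) :
    |ℓ n i - ℓ r i| ≤ cutVariation L T ℓ n i := by
  refine le_min ?_ ?_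
  · have h1 := h.mem (by omega : 1 ≤ n) hn i
    have h2 := h.mem hr (by omega) i
    rw [abs_le]
    constructor <;> linarith [h1.1, h1.2, h2.1, h2.2]
  · have h1 := abs_sub_le_sum_lossChange ℓ i (by omega : 1 ≤ n) hrn
    rw [if_neg (by omega)] at h1
    refine h1.trans ?_
    unfold blockVariation
    refine Finset.sum_le_sum_of_subset_of_nonneg (fun s hs => ?_)
      fun s _ _ => lossChange_nonneg ℓ s i
    rw [Finset.mem_Ioc] at hs
    rw [Finset.mem_filter, Finset.mem_Icc]
    have h3 : r / L ≤ s / L := Nat.div_le_div_right hs.1.le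
    have h4 : s / L ≤ n / L := Nat.div_le_div_right hs.2
    exact ⟨⟨by omega, by omega⟩, by omega⟩

theorem cutVariation_congr {L r n : ℕ} (hb : r / L = n / L) (i : Fin K) :
    cutVariation L T ℓ r i = cutVariation L T ℓ n i := by
  simp only [cutVariation, blockVariation, hb]

/-- Conditionally on the past, the arm drawn in a minority round is either a fresh one, which takes
every value with probability at most `4β`, or through the bias the last minority arm, with
probability at most `8η` times that of a minority round. The latter is absorbed in the left side. -/
theorem minority_cutVariation_le (h : Admissible η T ℓ) (hβ : 0 < β) {L t : ℕ} (ht0 : 1 ≤ t)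
    (ht : t < T) :
    (if a (t + 1) ∈ (run η β a ℓ t).S then cutVariation L T ℓ (t + 1) (a (t + 1)) -
        8 * η * cutVariation L T ℓ (t + 1) (a (run η β a ℓ t).τ) else 0) ≤
      4 * β * ∑ i, blockVariation L T ℓ (t + 1) i +
      deviation (run η β a ℓ t).w (switchWeight η β L T a ℓ t) (a (t + 1)) := by
  obtain ⟨n, rfl⟩ : ∃ n, t = n + 1 := ⟨t - 1, by omega⟩
  have hb := biasOf_mem (β := β) (a := a) h ht0 ht.le
  have hg := run_good (β := β) (a := a) h ht.le
  have hw := run_succ_w (η := η) (β := β) (a := a) (ℓ := ℓ) n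
  have hcut := fun i => cutVariation_mem (T := T) (ℓ := ℓ) L (n + 1 + 1) i
  have h1 := sum_biased_le (run η β a ℓ (n + 1)).S (a (run η β a ℓ (n + 1)).τ) hb.1
    hg.prox.mem_right.1 (fun i => (hcut i).1)
  rw [← hw] at h1
  set s := run η β a ℓ (n + 1) with hs
  have h2 : ∑ j, (if j ∈ s.S then s.x j else 0) * cutVariation L T ℓ (n + 1 + 1) j ≤
      4 * β * ∑ i, blockVariation L T ℓ (n + 1 + 1) i := by
    rw [Finset.mul_sum]
    refine Finset.sum_le_sum fun j _ => ?_
    have hv := blockVariation_nonneg (T := T) (ℓ := ℓ) L (n + 1 + 1) j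
    split_ifs with hj
    · have hj' := (mem_run_succ_S n j).1 hj
      have hx := (run_ratio (β := β) (a := a) h (Nat.lt_of_succ_lt ht) j).2
      have hx0 := hg.prox.mem_right.1 j
      exact mul_le_mul (by linarith) (min_le_right _ _) (hcut j).1 (by linarith)
    · rw [zero_mul]
      positivity
  have h3 : biasOf η a ℓ s * (∑ j ∈ s.S, s.w j) * cutVariation L T ℓ (n + 1 + 1) (a s.τ) ≤
      8 * η * (∑ j ∈ s.S, s.w j) * cutVariation L T ℓ (n + 1 + 1) (a s.τ) := by
    have h4 : 0 ≤ ∑ j ∈ s.S, s.w j := Finset.sum_nonneg fun j _ => (hg.w_pos j).le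
    have h5 := (hcut (a s.τ)).1
    gcongr
    exact hb.2
  have h6 : ∑ j, s.w j * switchWeight η β L T a ℓ (n + 1) j =
      ∑ j ∈ s.S, s.w j * cutVariation L T ℓ (n + 1 + 1) j -
        8 * η * (∑ j ∈ s.S, s.w j) * cutVariation L T ℓ (n + 1 + 1) (a s.τ) := by
    simp only [switchWeight, ← hs, mul_ite, mul_zero, Finset.sum_ite_mem, Finset.univ_inter, mul_sub,
      Finset.sum_sub_distrib, Finset.mul_sum, Finset.sum_mul]
    congr 1
    exact Finset.sum_congr rfl fun j _ => by ring
  rw [deviation, h6]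
  have h7 : switchWeight η β L T a ℓ (n + 1) (a (n + 1 + 1)) =
      if a (n + 1 + 1) ∈ s.S then cutVariation L T ℓ (n + 1 + 1) (a (n + 1 + 1)) -
        8 * η * cutVariation L T ℓ (n + 1 + 1) (a s.τ) else 0 := rfl
  rw [h7]
  linarith

/-- The cut variation of the last minority arm, over the block in which it was played. -/
def storedVariation (η β : ℝ) (L T : ℕ) (a : ℕ → Fin K) (ℓ : ℕ → Fin K → ℝ) (t : ℕ) : ℝ :=
  cutVariation L T ℓ (run η β a ℓ t).τ (a (run η β a ℓ t).τ)

/-- The first difference counts block changes between consecutive minority rounds. The second one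
re-indexes the variation of the stored arm to the round in which it was played. -/
theorem round_switchCost_le (h : Admissible η T ℓ) (hβ : 0 < β) {L t : ℕ} (ht0 : 1 ≤ t)
    (ht : t < T) :
    (1 - 8 * η) * switchCost η β a ℓ t ≤
      2 * (((run η β a ℓ (t + 1)).τ / L : ℕ) - ((run η β a ℓ t).τ / L : ℕ) : ℝ) +
      (storedVariation η β L T a ℓ t - storedVariation η β L T a ℓ (t + 1)) +
      4 * β * ∑ i, blockVariation L T ℓ (t + 1) i +
      deviation (run η β a ℓ t).w (switchWeight η β L T a ℓ t) (a (t + 1)) := by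
  have hmain := minority_cutVariation_le (β := β) (a := a) h hβ (L := L) ht0 ht
  have hτ := run_τ_mem (η := η) (β := β) (a := a) (ℓ := ℓ) ht0
  by_cases hk : a (t + 1) ∈ (run η β a ℓ t).S
  · rw [if_pos hk] at hmain
    rw [storedVariation, storedVariation, run_succ_τ, if_pos hk]
    have hc1 := switchCost_le_one (β := β) (a := a) h ht0 ht
    have hc0 := switchCost_nonneg (η := η) (β := β) (a := a) (ℓ := ℓ) t
    have hη := h.pos
    have hη1 := h.le
    have hv := cutVariation_mem (T := T) (ℓ := ℓ) L (t + 1) (a (run η β a ℓ t).τ)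
    have hv' := cutVariation_mem (T := T) (ℓ := ℓ) L (run η β a ℓ t).τ (a (run η β a ℓ t).τ)
    by_cases hb : (run η β a ℓ t).τ / L = (t + 1) / L
    · have hcost : switchCost η β a ℓ t ≤ cutVariation L T ℓ (t + 1) (a (run η β a ℓ t).τ) := by
        rw [switchCost, if_pos hk]
        exact abs_sub_le_cutVariation h hτ.1 (by omega) ht hb _
      rw [cutVariation_congr hb, hb, sub_self]
      nlinarith
    · have hlt : (run η β a ℓ t).τ / L + 1 ≤ (t + 1) / L := by
        have : (run η β a ℓ t).τ / L ≤ (t + 1) / L := Nat.div_le_div_right (by omega)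
        omega
      have hlt' : (((run η β a ℓ t).τ / L : ℕ) : ℝ) + 1 ≤ (((t + 1) / L : ℕ) : ℝ) := by
        exact_mod_cast hlt
      nlinarith [hv.1, hv.2, hv'.1]
  · rw [if_neg hk] at hmain
    have hp : storedVariation η β L T a ℓ (t + 1) = storedVariation η β L T a ℓ t := by
      rw [storedVariation, run_succ_τ, if_neg hk, storedVariation]
    rw [hp, run_succ_τ, if_neg hk, switchCost, if_neg hk]
    linarith

theorem sum_switchCost_le (h : Admissible η T ℓ) (hβ : 0 < β) (hT : 1 ≤ T) {L : ℕ} (hL : 1 ≤ L) :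
    (1 - 8 * η) * ∑ t ∈ Finset.Ico 1 T, switchCost η β a ℓ t ≤
      2 * (T / L : ℕ) + 1 + 4 * β * (L * ∑ t ∈ Finset.Icc 1 T, ∑ i, lossChange ℓ t i) +
      ∑ t ∈ Finset.Ico 1 T,
        deviation (run η β a ℓ t).w (switchWeight η β L T a ℓ t) (a (t + 1)) := by
  have key : ∀ n, 1 ≤ n → n ≤ T → (1 - 8 * η) * ∑ t ∈ Finset.Ico 1 n, switchCost η β a ℓ t ≤
      2 * (((run η β a ℓ n).τ / L : ℕ) - ((run η β a ℓ 1).τ / L : ℕ) : ℝ) +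
      (storedVariation η β L T a ℓ 1 - storedVariation η β L T a ℓ n) +
      4 * β * ∑ t ∈ Finset.Ico 1 n, ∑ i, blockVariation L T ℓ (t + 1) i +
      ∑ t ∈ Finset.Ico 1 n,
        deviation (run η β a ℓ t).w (switchWeight η β L T a ℓ t) (a (t + 1)) := by
    intro n hn
    induction n, hn using Nat.le_induction with
    | base => simp
    | succ n hn ih =>
      intro hnT
      have h1 := round_switchCost_le (a := a) h hβ (L := L) hn (Nat.lt_of_succ_le hnT)
      have h2 := ih (by omega)
      rw [Finset.sum_Ico_succ_top hn, Finset.sum_Ico_succ_top hn, Finset.sum_Ico_succ_top hn]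
      linarith
  have h1 := key T hT le_rfl
  have h2 : (((run η β a ℓ T).τ / L : ℕ) : ℝ) ≤ (T / L : ℕ) := by
    exact_mod_cast Nat.div_le_div_right (run_τ_mem hT).2
  have h3 : (0 : ℝ) ≤ ((run η β a ℓ 1).τ / L : ℕ) := Nat.cast_nonneg _
  have h4 : storedVariation η β L T a ℓ 1 ≤ 1 := (cutVariation_mem _ _ _).2
  have h5 : 0 ≤ storedVariation η β L T a ℓ T := (cutVariation_mem _ _ _).1
  have h6 : ∑ t ∈ Finset.Ico 1 T, ∑ i, blockVariation L T ℓ (t + 1) i ≤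
      L * ∑ t ∈ Finset.Icc 1 T, ∑ i, lossChange ℓ t i := by
    refine le_trans ?_ (sum_blockVariation_le (T := T) (ℓ := ℓ) hL)
    rw [Finset.sum_Ico_add' (fun t => ∑ i, blockVariation L T ℓ t i) 1 T 1]
    refine Finset.sum_le_sum_of_subset_of_nonneg (fun s hs => ?_) fun s _ _ =>
      Finset.sum_nonneg fun i _ => blockVariation_nonneg L s i
    rw [Finset.mem_Ico] at hs
    exact Finset.mem_Icc.2 ⟨by omega, by omega⟩
  have h7 : 4 * β * ∑ t ∈ Finset.Ico 1 T, ∑ i, blockVariation L T ℓ (t + 1) i ≤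
      4 * β * (L * ∑ t ∈ Finset.Icc 1 T, ∑ i, lossChange ℓ t i) := by gcongr
  linarith

end Pathwise

/-! ### Measurability of the run -/

section Measurability

variable {K : ℕ} {Ω : Type*} [mΩ : MeasurableSpace Ω]

/-- Evaluation of a family of measurable functions at a random index with finitely many values. -/
theorem measurable_select {ι γ : Type*} [MeasurableSpace ι] [MeasurableSingletonClass ι]
    [MeasurableSpace γ] {A : Finset ι} {σ : Ω → ι} {F : ι → Ω → γ} (hσ : Measurable σ)
    (hF : ∀ r ∈ A, Measurable (F r)) (hA : ∀ ω, σ ω ∈ A) : Measurable fun ω => F (σ ω) ω := by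
  intro s hs
  have h : (fun ω => F (σ ω) ω) ⁻¹' s = ⋃ r ∈ A, (σ ⁻¹' {r} ∩ F r ⁻¹' s) := by
    ext ω
    simp only [Set.mem_preimage, Set.mem_iUnion, Set.mem_inter_iff, Set.mem_singleton_iff]
    constructor
    · exact fun h => ⟨σ ω, hA ω, rfl, h⟩
    · rintro ⟨r, -, rfl, h⟩
      exact h
  rw [h]
  exact MeasurableSet.biUnion A.countable_toSet fun r hr =>
    (hσ (measurableSet_singleton r)).inter (hF r hr hs)

theorem measurable_select_fin {γ : Type*} [MeasurableSpace γ] {k : Ω → Fin K} {F : Fin K → Ω → γ}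
    (hk : Measurable k) (hF : ∀ r, Measurable (F r)) : Measurable fun ω => F (k ω) ω :=
  measurable_select (A := Finset.univ) hk (fun r _ => hF r) fun _ => Finset.mem_univ _

theorem measurableSet_mem_finset {S : Ω → Finset (Fin K)} {k : Ω → Fin K}
    (hS : ∀ i, MeasurableSet {ω | i ∈ S ω}) (hk : Measurable k) :
    MeasurableSet {ω | k ω ∈ S ω} := by
  have h : {ω | k ω ∈ S ω} = ⋃ i, (k ⁻¹' {i} ∩ {ω | i ∈ S ω}) := by
    ext ω
    simp
  rw [h]
  exact MeasurableSet.iUnion fun i => (hk (measurableSet_singleton i)).inter (hS i)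

theorem measurable_biased {S : Ω → Finset (Fin K)} {k : Ω → Fin K} {b : Ω → ℝ}
    {x : Ω → Fin K → ℝ} (hS : ∀ i, MeasurableSet {ω | i ∈ S ω}) (hk : Measurable k)
    (hb : Measurable b) (hx : Measurable x) :
    Measurable fun ω => biased (S ω) (k ω) (b ω) (x ω) := by
  have hxi : ∀ i, Measurable fun ω => x ω i := fun i => (measurable_pi_apply i).comp hx
  have hki : ∀ i, MeasurableSet {ω | i = k ω} := fun i => by
    have h := hk (measurableSet_singleton i)
    have e : {ω | i = k ω} = k ⁻¹' {i} := by
      ext ω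
      simp [eq_comm]
    rwa [e]
  have hSk : ∀ i, MeasurableSet {ω | i ∈ S ω \ {k ω}} := fun i => by
    have h : {ω | i ∈ S ω \ {k ω}} = {ω | i ∈ S ω} \ {ω | i = k ω} := by
      ext ω
      simp
    rw [h]
    exact (hS i).diff (hki i)
  have hsum : Measurable fun ω => ∑ j ∈ S ω \ {k ω}, x ω j := by
    have h : (fun ω => ∑ j ∈ S ω \ {k ω}, x ω j) =
        fun ω => ∑ j, if j ∈ S ω \ {k ω} then x ω j else 0 := by
      funext ω
      rw [Finset.sum_ite_mem, Finset.univ_inter]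
    rw [h]
    exact Finset.measurable_sum _ fun j _ => Measurable.ite (hSk j) (hxi j) measurable_const
  refine measurable_pi_lambda _ fun i => ?_
  unfold biased
  exact Measurable.ite (hSk i) ((hxi i).mul (measurable_const.sub hb))
    (Measurable.ite (hki i) ((hxi i).add (hb.mul hsum)) (hxi i))

variable {η β : ℝ} {T : ℕ} {loss : ℕ → Ω → Fin K → ℝ} {act : ℕ → Ω → Fin K}

theorem measurable_lastRound (i : Fin K) {t : ℕ}
    (ha : ∀ s ∈ Finset.Icc 1 t, Measurable (act s)) :
    Measurable fun ω => lastRound (fun s => act s ω) i t := by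
  induction t with
  | zero => exact measurable_const
  | succ t ih =>
    simp only [lastRound_succ]
    refine Measurable.ite ?_ measurable_const (ih fun s hs => ha s ?_)
    · exact ha (t + 1) (by simp) (measurableSet_singleton i)
    · rw [Finset.mem_Icc] at hs ⊢
      omega

/-- All components of a random state are measurable. -/
structure MeasurableState (s : Ω → State K) : Prop where
  x' : Measurable fun ω => (s ω).x'
  x : Measurable fun ω => (s ω).x
  w : Measurable fun ω => (s ω).w
  m : Measurable fun ω => (s ω).m
  S : ∀ i, MeasurableSet {ω | i ∈ (s ω).S}
  τ : Measurable fun ω => (s ω).τ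

theorem measurable_loss_act (hl : ∀ s ∈ Finset.Icc 1 T, Measurable (loss s)) {σ : Ω → ℕ} {n t : ℕ}
    (ha : ∀ s ∈ Finset.Icc 1 t, Measurable (act s)) (hn : n ∈ Finset.Icc 1 T)
    (hσ : Measurable σ) (hσt : ∀ ω, σ ω ∈ Finset.Icc 1 t) :
    Measurable fun ω => loss n ω (act (σ ω) ω) :=
  measurable_select (F := fun r ω => loss n ω (act r ω)) hσ
    (fun r hr => measurable_select_fin (F := fun k ω => loss n ω k) (ha r hr)
      fun k => (measurable_pi_apply k).comp (hl n hn)) hσt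

theorem measurable_stored (hl : ∀ s ∈ Finset.Icc 1 T, Measurable (loss s)) {σ : Ω → ℕ} {t : ℕ}
    (htT : t ≤ T) (ha : ∀ s ∈ Finset.Icc 1 t, Measurable (act s))
    (hσ : Measurable σ) (hσt : ∀ ω, σ ω ∈ Finset.Icc 1 t) :
    Measurable fun ω => loss (σ ω) ω (act (σ ω) ω) :=
  measurable_select (F := fun r ω => loss r ω (act r ω)) hσ
    (fun r hr => measurable_select_fin (F := fun k ω => loss r ω k) (ha r hr)
      fun k => (measurable_pi_apply k).comp (hl r (by
        rw [Finset.mem_Icc] at hr ⊢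
        omega))) hσt

theorem measurableState_run (hadm : ∀ ω, Admissible η T fun s => loss s ω)
    (hl : ∀ s ∈ Finset.Icc 1 T, Measurable (loss s)) {t : ℕ} (ht : t ≤ T)
    (ha : ∀ s ∈ Finset.Icc 1 t, Measurable (act s)) :
    MeasurableState fun ω => run η β (fun s => act s ω) (fun s => loss s ω) t := by
  induction t with
  | zero =>
    exact ⟨measurable_const, measurable_const, measurable_const, measurable_const,
      fun i => MeasurableSet.const _, measurable_const⟩
  | succ t ih =>
    have ha' : ∀ s ∈ Finset.Icc 1 t, Measurable (act s) := fun s hs => ha s (by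
      rw [Finset.mem_Icc] at hs ⊢
      omega)
    have ih := ih (by omega) ha'
    have hat : Measurable (act (t + 1)) := ha (t + 1) (by simp)
    have hlt := hl (t + 1) (Finset.mem_Icc.2 ⟨by omega, ht⟩)
    have hS : ∀ i, MeasurableSet
        {ω | i ∈ (run η β (fun s => act s ω) (fun s => loss s ω) (t + 1)).S} := by
      intro i
      simp only [mem_run_succ_S]
      exact measurableSet_lt ((measurable_pi_apply i).comp ih.x) measurable_const
    have hτ : Measurable fun ω =>
        (run η β (fun s => act s ω) (fun s => loss s ω) (t + 1)).τ := by
      simp only [run_succ_τ]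
      exact Measurable.ite (measurableSet_mem_finset ih.S hat) measurable_const ih.τ
    have hτt : ∀ ω, (run η β (fun s => act s ω) (fun s => loss s ω) (t + 1)).τ ∈
        Finset.Icc 1 (t + 1) := fun ω => Finset.mem_Icc.2 (run_τ_mem (by omega))
    have hstored := measurable_stored hl ht ha hτ hτt
    have hm : Measurable fun ω =>
        (run η β (fun s => act s ω) (fun s => loss s ω) (t + 1)).m := by
      refine measurable_pi_lambda _ fun i => ?_
      simp only [run_succ_m]
      refine Measurable.ite (hS i) hstored ?_
      refine measurable_select (A := Finset.range (t + 2))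
        (F := fun r ω => if r = 0 then 0 else loss r ω (act r ω))
        (measurable_lastRound i ha) (fun r hr => ?_) (fun ω => ?_)
      · split_ifs with h0
        · exact measurable_const
        · rw [Finset.mem_range] at hr
          exact measurable_stored hl ht ha (σ := fun _ => r) measurable_const
            fun _ => Finset.mem_Icc.2 ⟨by omega, by omega⟩
      · have := lastRound_le (a := fun s => act s ω) i (t + 1)
        exact Finset.mem_range.2 (by omega)
    have hest : Measurable fun ω =>
        lossEst (run η β (fun s => act s ω) (fun s => loss s ω) t) (act (t + 1) ω)
          (loss (t + 1) ω (act (t + 1) ω)) := by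
      refine measurable_pi_lambda _ fun i => ?_
      have hobs : Measurable fun ω => loss (t + 1) ω (act (t + 1) ω) :=
        measurable_select_fin (F := fun k ω => loss (t + 1) ω k) hat
          fun k => (measurable_pi_apply k).comp hlt
      have hmi := (measurable_pi_apply i).comp ih.m
      unfold lossEst
      refine Measurable.add (Measurable.ite (hat (measurableSet_singleton i)) ?_
        measurable_const) hmi
      exact (hobs.sub hmi).div ((measurable_pi_apply i).comp ih.w)
    have hx' := measurable_of_isProx hest ih.x' fun ω => run_prox (hadm ω) (Nat.lt_of_succ_le ht)
    have hx := measurable_of_isProx hm hx' fun ω => (run_good (hadm ω) ht).prox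
    refine ⟨hx', hx, ?_, hm, hS, hτ⟩
    simp only [run_succ_w]
    have hb : Measurable fun ω => biasOf η (fun s => act s ω) (fun s => loss s ω)
        (run η β (fun s => act s ω) (fun s => loss s ω) (t + 1)) :=
      (measurable_const.sub hstored).const_mul _
    exact measurable_biased hS
      (measurable_select (F := fun r ω => act r ω) hτ ha hτt)
      (hb.div (measurable_const.add hb)) hx

theorem measurable_lossChange (hl : ∀ s ∈ Finset.Icc 1 T, Measurable (loss s)) {t : ℕ}
    (ht : t ∈ Finset.Icc 1 T) (i : Fin K) :
    Measurable fun ω => lossChange (fun s => loss s ω) t i := by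
  unfold lossChange
  have h1 : Measurable fun ω => loss t ω i := (measurable_pi_apply i).comp (hl t ht)
  have h2 : Measurable fun ω => if t = 1 then 0 else loss (t - 1) ω i := by
    split_ifs with h
    · exact measurable_const
    · rw [Finset.mem_Icc] at ht
      exact (measurable_pi_apply i).comp (hl (t - 1) (Finset.mem_Icc.2 ⟨by omega, by omega⟩))
  exact (h1.sub h2).abs

theorem measurable_cutVariation (hl : ∀ s ∈ Finset.Icc 1 T, Measurable (loss s)) (L n : ℕ)
    (i : Fin K) : Measurable fun ω => cutVariation L T (fun s => loss s ω) n i :=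
  measurable_const.min (Finset.measurable_sum _ fun _ hs =>
    measurable_lossChange hl (Finset.mem_filter.1 hs).1 i)

theorem measurable_correctedLoss (hadm : ∀ ω, Admissible η T fun s => loss s ω)
    (hl : ∀ s ∈ Finset.Icc 1 T, Measurable (loss s)) {t : ℕ} (ht : t < T)
    (ha : ∀ s ∈ Finset.Icc 1 t, Measurable (act s)) (u : Fin K → ℝ) (j : Fin K) :
    Measurable fun ω => correctedLoss η β (fun s => act s ω) (fun s => loss s ω) u t j := by
  have hs := measurableState_run (β := β) hadm hl ht.le ha
  have hT : t + 1 ∈ Finset.Icc 1 T := Finset.mem_Icc.2 ⟨by omega, ht⟩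
  have h1 : Measurable fun ω => loss (t + 1) ω j := (measurable_pi_apply j).comp (hl _ hT)
  unfold correctedLoss
  refine ((h1.sub ?_)).sub ?_
  · exact ((((measurable_pi_apply j).comp hs.x).sub measurable_const).mul
      (h1.sub ((measurable_pi_apply j).comp hs.m))).div ((measurable_pi_apply j).comp hs.w)
  · rcases Nat.eq_zero_or_pos t with rfl | h0
    · simp
    · have hτt : ∀ ω, (run η β (fun s => act s ω) (fun s => loss s ω) t).τ ∈
        Finset.Icc 1 t := fun ω => Finset.mem_Icc.2 (run_τ_mem h0)
      refine Measurable.ite ?_ ?_ measurable_const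
      · simp only [ne_eq, (show t ≠ 0 by omega), not_false_eq_true, true_and]
        exact hs.S j
      · refine Measurable.mul ?_ ((measurable_loss_act hl ha hT hs.τ hτt).sub h1)
        exact (measurable_const.sub (measurable_stored hl ht.le ha hs.τ hτt)).const_mul _

theorem measurable_switchWeight (hadm : ∀ ω, Admissible η T fun s => loss s ω)
    (hl : ∀ s ∈ Finset.Icc 1 T, Measurable (loss s)) {t : ℕ} (ht0 : 1 ≤ t) (ht : t < T)
    (ha : ∀ s ∈ Finset.Icc 1 t, Measurable (act s)) (L : ℕ) (j : Fin K) :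
    Measurable fun ω => switchWeight η β L T (fun s => act s ω) (fun s => loss s ω) t j := by
  have hs := measurableState_run (β := β) hadm hl ht.le ha
  have hτt : ∀ ω, (run η β (fun s => act s ω) (fun s => loss s ω) t).τ ∈
    Finset.Icc 1 t := fun ω => Finset.mem_Icc.2 (run_τ_mem ht0)
  refine Measurable.ite (hs.S j) ((measurable_cutVariation hl L (t + 1) j).sub
    (Measurable.const_mul ?_ _)) measurable_const
  exact measurable_select_fin
    (F := fun k ω => cutVariation L T (fun s => loss s ω) (t + 1) k)
    (measurable_select (F := fun r ω => act r ω) hs.τ ha hτt)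
    fun k => measurable_cutVariation hl L (t + 1) k

theorem measurable_switchCost (hadm : ∀ ω, Admissible η T fun s => loss s ω)
    (hl : ∀ s ∈ Finset.Icc 1 T, Measurable (loss s)) {t : ℕ} (ht0 : 1 ≤ t) (ht : t < T)
    (ha : ∀ s ∈ Finset.Icc 1 T, Measurable (act s)) :
    Measurable fun ω => switchCost η β (fun s => act s ω) (fun s => loss s ω) t := by
  have ha' : ∀ s ∈ Finset.Icc 1 t, Measurable (act s) := fun s hs => ha s (by
    rw [Finset.mem_Icc] at hs ⊢
    omega)
  have hs := measurableState_run (β := β) hadm hl ht.le ha'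
  have hT : t + 1 ∈ Finset.Icc 1 T := Finset.mem_Icc.2 ⟨by omega, ht⟩
  have hτt : ∀ ω, (run η β (fun s => act s ω) (fun s => loss s ω) t).τ ∈
    Finset.Icc 1 t := fun ω => Finset.mem_Icc.2 (run_τ_mem ht0)
  exact Measurable.ite (measurableSet_mem_finset hs.S (ha _ hT))
    ((measurable_loss_act hl ha' hT hs.τ hτt).sub
      (measurable_stored hl ht.le ha' hs.τ hτt)).abs measurable_const

end Measurability

/-! ### Bounds on the integrands -/

section Bounds

variable {K : ℕ} {η β : ℝ} {a : ℕ → Fin K} {ℓ : ℕ → Fin K → ℝ} {T : ℕ}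

/-- A crude bound, used only for integrability. -/
theorem abs_correctedLoss_le (h : Admissible η T ℓ) {t : ℕ} (ht : t < T) {u : Fin K → ℝ}
    (hu : u ∈ simplex K) (j : Fin K) :
    |correctedLoss η β a ℓ u t j| ≤ 2 + 2 * (K * 4 ^ t) := by
  have hg := run_good (β := β) (a := a) h ht.le
  have hT := h.mem (Nat.le_add_left 1 t) ht
  have hK : (0 : ℝ) < K := by exact_mod_cast j.pos
  have hx := run_x_ge (β := β) (a := a) h ht.le j
  have hw : 1 / (2 * (K * 4 ^ t)) ≤ (run η β a ℓ t).w j := by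
    have h1 := hg.x_le j
    have h2 : 1 / (K : ℝ) * (1 / 4) ^ t = 2 * (1 / (2 * (K * 4 ^ t))) := by
      rw [one_div (4 : ℝ), inv_pow]
      field_simp
    have h3 : 0 < 1 / (2 * ((K : ℝ) * 4 ^ t)) := by positivity
    linarith
  have hdiv : |((run η β a ℓ t).x j - u j) * (ℓ (t + 1) j - (run η β a ℓ t).m j) /
      (run η β a ℓ t).w j| ≤ 2 * (K * 4 ^ t) := by
    rw [abs_div, abs_mul, abs_of_pos (hg.w_pos j), div_le_iff₀ (hg.w_pos j)]
    have h1 : |(run η β a ℓ t).x j - u j| ≤ 1 := by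
      have := simplex_le_one hg.prox.mem_right j
      have := hg.prox.mem_right.1 j
      have := simplex_le_one hu j
      have := hu.1 j
      rw [abs_le]
      constructor <;> linarith
    have h2 := hg.abs_sub_le (i := j) (hT j)
    rw [div_le_iff₀ (by positivity)] at hw
    nlinarith [abs_nonneg ((run η β a ℓ t).x j - u j),
      abs_nonneg (ℓ (t + 1) j - (run η β a ℓ t).m j)]
  have hbias : |if t ≠ 0 ∧ j ∈ (run η β a ℓ t).S then
      biasOf η a ℓ (run η β a ℓ t) * (ℓ (t + 1) (a (run η β a ℓ t).τ) - ℓ (t + 1) j)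
      else 0| ≤ 1 := by
    split_ifs with h0
    · have hb := biasOf_mem (β := β) (a := a) h (Nat.one_le_iff_ne_zero.2 h0.1) ht.le
      rw [abs_mul, abs_of_nonneg hb.1]
      have h1 : |ℓ (t + 1) (a (run η β a ℓ t).τ) - ℓ (t + 1) j| ≤ 1 := by
        rw [abs_le]
        constructor <;> linarith [(hT (a (run η β a ℓ t).τ)).1, (hT (a (run η β a ℓ t).τ)).2,
          (hT j).1, (hT j).2]
      exact mul_le_one₀ (by linarith [hb.2, h.le]) (abs_nonneg _) h1
    · simp
  have hl : |ℓ (t + 1) j| ≤ 1 := by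
    rw [abs_of_nonneg (hT j).1]
    exact (hT j).2
  unfold correctedLoss
  refine (abs_sub _ _).trans ?_
  refine (add_le_add (abs_sub _ _) le_rfl).trans ?_
  linarith

theorem abs_switchWeight_le (h : Admissible η T ℓ) (L t : ℕ) (j : Fin K) :
    |switchWeight η β L T a ℓ t j| ≤ 1 := by
  unfold switchWeight
  split_ifs
  · have h1 := cutVariation_mem (T := T) (ℓ := ℓ) L (t + 1) j
    have h2 := cutVariation_mem (T := T) (ℓ := ℓ) L (t + 1) (a (run η β a ℓ t).τ)
    have := h.pos
    have := h.le
    rw [abs_le]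
    constructor <;> nlinarith [h1.1, h1.2, h2.1, h2.2]
  · simp

theorem lossChange_le_one (h : Admissible η T ℓ) {t : ℕ} (ht : t ∈ Finset.Icc 1 T) (i : Fin K) :
    lossChange ℓ t i ≤ 1 := by
  have h1 := h.loss_mem t ht i
  rw [Finset.mem_Icc] at ht
  unfold lossChange
  split_ifs with h0
  · rw [sub_zero, abs_of_nonneg h1.1]
    exact h1.2
  · have h2 := h.mem (t := t - 1) (by omega) (by omega) i
    rw [abs_le]
    constructor <;> linarith [h1.1, h1.2, h2.1, h2.2]

end Bounds

/-! ### Expected regret -/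

theorem measurable_loss_information {K : ℕ} {Ω : Type*} {T : ℕ} {loss : ℕ → Ω → Fin K → ℝ}
    {act : ℕ → Ω → Fin K} (t : ℕ) :
    ∀ s ∈ Finset.Icc 1 T, Measurable[information T loss act t] (loss s) := fun s hs =>
  Measurable.of_comap_le (le_sup_of_le_left
    (le_iSup₂ (f := fun s (_ : s ∈ Finset.Icc 1 T) =>
      MeasurableSpace.comap (loss s) inferInstance) s hs))

theorem measurable_act_information {K : ℕ} {Ω : Type*} {T : ℕ} {loss : ℕ → Ω → Fin K → ℝ}
    {act : ℕ → Ω → Fin K} (t : ℕ) :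
    ∀ s ∈ Finset.Icc 1 t, Measurable[information T loss act t] (act s) := fun s hs =>
  Measurable.of_comap_le (le_sup_of_le_right
    (le_iSup₂ (f := fun s (_ : s ∈ Finset.Icc 1 t) =>
      MeasurableSpace.comap (act s) inferInstance) s hs))

section Expectation

variable {K : ℕ} {Ω : Type*} [mΩ : MeasurableSpace Ω] {η β : ℝ} {T : ℕ} {μ : Measure Ω}
  {loss : ℕ → Ω → Fin K → ℝ} {act : ℕ → Ω → Fin K}

theorem information_le (h : IsObliviousRun η (8 * η) β T μ loss act) {t : ℕ} (ht : t ≤ T) :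
    information T loss act t ≤ mΩ := by
  refine sup_le (iSup₂_le fun s hs => (h.measurable_loss s hs).comap_le)
    (iSup₂_le fun s hs => (h.measurable_act s ?_).comap_le)
  rw [Finset.mem_Icc] at hs ⊢
  omega

theorem admissible_of_run (h : IsObliviousRun η (8 * η) β T μ loss act) (hη : 0 < η)
    (hη1 : η ≤ 1 / 162) (ω : Ω) : Admissible η T fun s => loss s ω :=
  ⟨hη, hη1, fun t ht i => h.loss_mem t ht ω i⟩

theorem integrable_of_measurable_bounded [IsProbabilityMeasure μ] {f : Ω → ℝ} (hf : Measurable f)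
    {C : ℝ} (hC : ∀ ω, |f ω| ≤ C) : Integrable f μ :=
  Integrable.of_bound hf.aestronglyMeasurable C (Filter.Eventually.of_forall hC)

/-- The only place where the sampling assumption, and with it obliviousness, is used: the function
`G` of the arm drawn may depend on the losses of all rounds. -/
theorem integral_deviation [IsProbabilityMeasure μ]
    (h : IsObliviousRun η (8 * η) β T μ loss act) (hη : 0 < η) (hη1 : η ≤ 1 / 162) {t : ℕ}
    (ht : t < T) {G : Ω → Fin K → ℝ} (hG : ∀ j, Measurable[information T loss act t] fun ω => G ω j)
    {C : ℝ} (hC : ∀ ω j, |G ω j| ≤ C) :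
    Integrable (fun ω => deviation (run η β (fun s => act s ω) (fun s => loss s ω) t).w (G ω)
      (act (t + 1) ω)) μ ∧
    ∫ ω, deviation (run η β (fun s => act s ω) (fun s => loss s ω) t).w (G ω)
      (act (t + 1) ω) ∂μ = 0 := by
  classical
  have hle := information_le h ht.le
  have hadm := admissible_of_run h hη hη1
  have hT : t + 1 ∈ Finset.Icc 1 T := Finset.mem_Icc.2 ⟨by omega, ht⟩
  have hact := h.measurable_act (t + 1) hT
  have hs := measurableState_run (β := β) hadm h.measurable_loss ht.le fun s hs =>
    h.measurable_act s (by
      rw [Finset.mem_Icc] at hs ⊢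
      omega)
  have hGm : ∀ j, Measurable fun ω => G ω j := fun j => (hG j).mono hle le_rfl
  have hwm : ∀ j, Measurable fun ω =>
      (run η β (fun s => act s ω) (fun s => loss s ω) t).w j := fun j =>
    (measurable_pi_apply j).comp hs.w
  have hind : ∀ j, Measurable fun ω => if act (t + 1) ω = j then (1 : ℝ) else 0 := fun j =>
    Measurable.ite (hact (measurableSet_singleton j)) measurable_const measurable_const
  have hi1 : ∀ j, Integrable (fun ω => (if act (t + 1) ω = j then (1 : ℝ) else 0) * G ω j) μ := by
    intro j
    refine integrable_of_measurable_bounded ((hind j).mul (hGm j)) (C := C) fun ω => ?_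
    rw [abs_mul]
    split_ifs
    · simpa using hC ω j
    · simpa using (abs_nonneg _).trans (hC ω j)
  have hi2 : ∀ j, Integrable (fun ω =>
      (run η β (fun s => act s ω) (fun s => loss s ω) t).w j * G ω j) μ := by
    intro j
    refine integrable_of_measurable_bounded ((hwm j).mul (hGm j)) (C := C) fun ω => ?_
    have hg := run_good (β := β) (a := fun s => act s ω) (hadm ω) ht.le
    rw [abs_mul, abs_of_pos (hg.w_pos j)]
    have h1 := hg.w_le_one j
    have h2 := hC ω j
    have h3 := hg.w_pos j
    nlinarith [abs_nonneg (G ω j)]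
  have heq : ∀ j, ∫ ω, (if act (t + 1) ω = j then (1 : ℝ) else 0) * G ω j ∂μ =
      ∫ ω, (run η β (fun s => act s ω) (fun s => loss s ω) t).w j * G ω j ∂μ := by
    intro j
    rw [← integral_condExp hle]
    refine integral_congr_ae ?_
    have hpull := condExp_mul_of_stronglyMeasurable_right (μ := μ)
      (m := information T loss act t) (f := fun ω => if act (t + 1) ω = j then (1 : ℝ) else 0)
      (g := fun ω => G ω j) (hG j).stronglyMeasurable (hi1 j)
      (integrable_of_measurable_bounded (hind j) (C := 1) fun ω => by split_ifs <;> simp)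
    refine hpull.trans ?_
    filter_upwards [h.sampling t ht j] with ω hω
    have hω' : μ[fun ω => if act (t + 1) ω = j then (1 : ℝ) else 0 | information T loss act t] ω =
        (run η β (fun s => act s ω) (fun s => loss s ω) t).w j := by
      rw [run, ← hω]
    rw [Pi.mul_apply, hω']
  have hdev : (fun ω => deviation (run η β (fun s => act s ω) (fun s => loss s ω) t).w (G ω)
      (act (t + 1) ω)) = fun ω => ∑ j, ((if act (t + 1) ω = j then (1 : ℝ) else 0) * G ω j -
        (run η β (fun s => act s ω) (fun s => loss s ω) t).w j * G ω j) := by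
    funext ω
    simp [deviation, Finset.sum_sub_distrib, ite_mul]
  have hi : ∀ j ∈ Finset.univ, Integrable (fun ω =>
      (if act (t + 1) ω = j then (1 : ℝ) else 0) * G ω j -
        (run η β (fun s => act s ω) (fun s => loss s ω) t).w j * G ω j) μ :=
    fun j _ => (hi1 j).sub (hi2 j)
  rw [hdev]
  refine ⟨integrable_finsetSum _ hi, ?_⟩
  rw [integral_finsetSum _ hi]
  refine Finset.sum_eq_zero fun j _ => ?_
  rw [integral_sub (hi1 j) (hi2 j), heq j, sub_self]

theorem integrable_loss_act [IsProbabilityMeasure μ] (h : IsObliviousRun η (8 * η) β T μ loss act)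
    {t : ℕ} (ht : t ∈ Finset.Icc 1 T) : Integrable (fun ω => loss t ω (act t ω)) μ := by
  refine integrable_of_measurable_bounded (C := 1) ?_ fun ω => ?_
  · exact measurable_select_fin (F := fun k ω => loss t ω k) (h.measurable_act t ht)
      fun k => (measurable_pi_apply k).comp (h.measurable_loss t ht)
  · have := h.loss_mem t ht ω (act t ω)
    rw [abs_of_nonneg this.1]
    exact this.2

theorem integrable_loss [IsProbabilityMeasure μ] (h : IsObliviousRun η (8 * η) β T μ loss act)
    {t : ℕ} (ht : t ∈ Finset.Icc 1 T) (i : Fin K) : Integrable (fun ω => loss t ω i) μ := by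
  refine integrable_of_measurable_bounded (C := 1)
    ((measurable_pi_apply i).comp (h.measurable_loss t ht)) fun ω => ?_
  have := h.loss_mem t ht ω i
  rw [abs_of_nonneg this.1]
  exact this.2

theorem integrable_pathLength [IsProbabilityMeasure μ]
    (h : IsObliviousRun η (8 * η) β T μ loss act) (hη : 0 < η) (hη1 : η ≤ 1 / 162) :
    Integrable (fun ω => ∑ t ∈ Finset.Icc 1 T, ∑ i, lossChange (fun s => loss s ω) t i) μ := by
  refine integrable_finsetSum _ fun t ht => integrable_finsetSum _ fun i _ => ?_
  refine integrable_of_measurable_bounded (C := 1)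
    (measurable_lossChange h.measurable_loss ht i) fun ω => ?_
  rw [abs_of_nonneg (lossChange_nonneg _ t i)]
  exact lossChange_le_one (admissible_of_run h hη hη1 ω) ht i

theorem pathLength_eq : pathLength μ T loss =
    ∫ ω, ∑ t ∈ Finset.Icc 1 T, ∑ i, lossChange (fun s => loss s ω) t i ∂μ := rfl

theorem pathLength_nonneg : 0 ≤ pathLength μ T loss :=
  integral_nonneg fun _ => Finset.sum_nonneg fun _ _ => Finset.sum_nonneg fun _ _ => abs_nonneg _

theorem pathLength_le [IsProbabilityMeasure μ]
    (h : IsObliviousRun η (8 * η) β T μ loss act) (hη : 0 < η) (hη1 : η ≤ 1 / 162) :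
    pathLength μ T loss ≤ K * T := by
  have h1 : pathLength μ T loss ≤ ∫ _ω : Ω, (K * T : ℝ) ∂μ := by
    rw [pathLength_eq]
    refine integral_mono (integrable_pathLength h hη hη1) (integrable_const _) fun ω => ?_
    have h2 : ∑ t ∈ Finset.Icc 1 T, ∑ i, lossChange (fun s => loss s ω) t i ≤
        ∑ t ∈ Finset.Icc 1 T, ∑ _i : Fin K, (1 : ℝ) := Finset.sum_le_sum fun t ht =>
      Finset.sum_le_sum fun i _ => lossChange_le_one (admissible_of_run h hη hη1 ω) ht i
    refine h2.trans (le_of_eq ?_)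
    simp [mul_comm]
  simpa using h1

theorem regret_le_of_forall (hK : 1 ≤ K) {B : ℝ}
    (hB : ∀ i, ∫ ω, (∑ t ∈ Finset.Icc 1 T, loss t ω (act t ω) -
      ∑ t ∈ Finset.Icc 1 T, loss t ω i) ∂μ ≤ B) : regret μ T loss act ≤ B := by
  have : Nonempty (Fin K) := ⟨⟨0, hK⟩⟩
  exact ciSup_le hB

theorem regret_le_rounds [IsProbabilityMeasure μ] (hK : 1 ≤ K)
    (h : IsObliviousRun η (8 * η) β T μ loss act) : regret μ T loss act ≤ T := by
  refine regret_le_of_forall hK fun i => ?_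
  have h1 : ∫ ω, (∑ t ∈ Finset.Icc 1 T, loss t ω (act t ω) -
      ∑ t ∈ Finset.Icc 1 T, loss t ω i) ∂μ ≤ ∫ _ω : Ω, (T : ℝ) ∂μ := by
    refine integral_mono ((integrable_finsetSum _ fun t ht => integrable_loss_act h ht).sub
      (integrable_finsetSum _ fun t ht => integrable_loss h ht i)) (integrable_const _) fun ω => ?_
    have h2 : ∑ t ∈ Finset.Icc 1 T, loss t ω (act t ω) ≤ ∑ t ∈ Finset.Icc 1 T, (1 : ℝ) :=
      Finset.sum_le_sum fun t ht => (h.loss_mem t ht ω _).2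
    have h3 : 0 ≤ ∑ t ∈ Finset.Icc 1 T, loss t ω i :=
      Finset.sum_nonneg fun t ht => (h.loss_mem t ht ω i).1
    simp only [Finset.sum_const, Nat.card_Icc, Nat.add_sub_cancel, nsmul_eq_mul, mul_one] at h2
    linarith
  simpa using h1

/-- The expected total switching cost. -/
def expSwitchCost (η β : ℝ) (T : ℕ) (μ : Measure Ω) (loss : ℕ → Ω → Fin K → ℝ)
    (act : ℕ → Ω → Fin K) : ℝ :=
  ∫ ω, ∑ t ∈ Finset.Ico 1 T, switchCost η β (fun s => act s ω) (fun s => loss s ω) t ∂μ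

theorem integrable_switchCost [IsProbabilityMeasure μ]
    (h : IsObliviousRun η (8 * η) β T μ loss act) (hη : 0 < η) (hη1 : η ≤ 1 / 162) :
    Integrable (fun ω => ∑ t ∈ Finset.Ico 1 T,
      switchCost η β (fun s => act s ω) (fun s => loss s ω) t) μ := by
  refine integrable_finsetSum _ fun t ht => ?_
  rw [Finset.mem_Ico] at ht
  have hadm := admissible_of_run h hη hη1
  refine integrable_of_measurable_bounded (C := 1)
    (measurable_switchCost hadm h.measurable_loss ht.1 ht.2 h.measurable_act) fun ω => ?_
  rw [abs_of_nonneg (switchCost_nonneg t)]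
  exact switchCost_le_one (hadm ω) ht.1 ht.2

theorem expSwitchCost_le_rounds [IsProbabilityMeasure μ]
    (h : IsObliviousRun η (8 * η) β T μ loss act) (hη : 0 < η) (hη1 : η ≤ 1 / 162) :
    expSwitchCost η β T μ loss act ≤ T := by
  have h1 : expSwitchCost η β T μ loss act ≤ ∫ _ω : Ω, (T : ℝ) ∂μ := by
    refine integral_mono (integrable_switchCost h hη hη1) (integrable_const _) fun ω => ?_
    have h2 : ∑ t ∈ Finset.Ico 1 T, switchCost η β (fun s => act s ω) (fun s => loss s ω) t ≤
        ∑ t ∈ Finset.Ico 1 T, (1 : ℝ) := Finset.sum_le_sum fun t ht => by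
      rw [Finset.mem_Ico] at ht
      exact switchCost_le_one (admissible_of_run h hη hη1 ω) ht.1 ht.2
    refine h2.trans ?_
    simp only [Finset.sum_const, Nat.card_Ico, nsmul_eq_mul, mul_one]
    exact_mod_cast Nat.sub_le T 1
  simpa using h1

theorem expSwitchCost_le_blocks [IsProbabilityMeasure μ]
    (h : IsObliviousRun η (8 * η) β T μ loss act) (hη : 0 < η) (hη1 : η ≤ 1 / 162) (hβ : 0 < β)
    (hT : 1 ≤ T) {L : ℕ} (hL : 1 ≤ L) :
    (1 - 8 * η) * expSwitchCost η β T μ loss act ≤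
      2 * (T / L : ℕ) + 1 + 4 * β * (L * pathLength μ T loss) := by
  have hadm := admissible_of_run h hη hη1
  have hdev : ∀ t ∈ Finset.Ico 1 T, _ := fun t ht =>
    integral_deviation (β := β) h hη hη1 (Finset.mem_Ico.1 ht).2
      (G := fun ω => switchWeight η β L T (fun s => act s ω) (fun s => loss s ω) t)
      (fun j => measurable_switchWeight (mΩ := information T loss act t) hadm
        (measurable_loss_information t) (Finset.mem_Ico.1 ht).1 (Finset.mem_Ico.1 ht).2
        (measurable_act_information t) L j)
      (fun ω j => abs_switchWeight_le (hadm ω) L t j)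
  have hV := integrable_pathLength h hη hη1
  have hint : Integrable (fun ω => (2 * (T / L : ℕ) + 1 : ℝ) + 4 * β * (L *
      ∑ t ∈ Finset.Icc 1 T, ∑ i, lossChange (fun s => loss s ω) t i)) μ :=
    (integrable_const _).add ((hV.const_mul _).const_mul _)
  have hint' := integrable_finsetSum _ fun t ht => (hdev t ht).1
  rw [expSwitchCost, ← integral_const_mul]
  refine (integral_mono ((integrable_switchCost h hη hη1).const_mul _) (hint.add hint')
    fun ω => sum_switchCost_le (hadm ω) hβ hT hL).trans (le_of_eq ?_)
  rw [integral_add' hint hint', integral_finsetSum _ fun t ht => (hdev t ht).1,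
    Finset.sum_eq_zero fun t ht => (hdev t ht).2, add_zero,
    integral_add (integrable_const _) ((hV.const_mul _).const_mul _), integral_const_mul,
    integral_const_mul, ← pathLength_eq]
  simp

/-- The comparator: the arm `i`, moved slightly towards the uniform distribution so that the
log-barrier is finite. -/
def comparator (K T : ℕ) (i j : Fin K) : ℝ :=
  (if j = i then 1 - 1 / (T : ℝ) else 0) + 1 / (T * K : ℝ)

theorem comparator_mem (hK : 1 ≤ K) (hT : 2 ≤ T) (i : Fin K) :
    comparator K T i ∈ simplex K := by
  have hK' : (0 : ℝ) < K := by exact_mod_cast hK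
  have hT' : (2 : ℝ) ≤ T := by exact_mod_cast hT
  have h1 : 0 ≤ 1 - 1 / (T : ℝ) := by
    rw [sub_nonneg, div_le_one (by linarith)]
    linarith
  refine ⟨fun j => ?_, ?_⟩
  · unfold comparator
    split_ifs <;> positivity
  · simp only [comparator, Finset.sum_add_distrib, Finset.sum_ite_eq', Finset.mem_univ, if_true,
      Finset.sum_const, Finset.card_univ, Fintype.card_fin, nsmul_eq_mul]
    field_simp
    ring

theorem comparator_loss_le {ℓ : Fin K → ℝ} (hK : 1 ≤ K) (hT : 2 ≤ T) (i : Fin K)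
    (hℓ : ∀ j, ℓ j ∈ Set.Icc (0 : ℝ) 1) :
    ∑ j, comparator K T i j * ℓ j ≤ ℓ i + 1 / T := by
  have hK' : (0 : ℝ) < K := by exact_mod_cast hK
  have hT' : (0 : ℝ) < T := by exact_mod_cast (by omega : 0 < T)
  simp only [comparator, add_mul, Finset.sum_add_distrib, ite_mul, zero_mul, Finset.sum_ite_eq',
    Finset.mem_univ, if_true, ← Finset.mul_sum]
  have h1 : ∑ j, ℓ j ≤ K := by
    have := Finset.sum_le_sum fun j (_ : j ∈ Finset.univ) => (hℓ j).2
    simpa using this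
  have h2 : 1 / (T * K : ℝ) * ∑ j, ℓ j ≤ 1 / (T * K : ℝ) * K := by gcongr
  have h3 : 1 / (T * K : ℝ) * K = 1 / T := by field_simp
  have h4 : 0 ≤ 1 / (T : ℝ) * ℓ i := mul_nonneg (by positivity) (hℓ i).1
  linarith

theorem sum_coordDiv_comparator_le (hK : 1 ≤ K) (hT : 2 ≤ T) (hKT : K ≤ T) (i : Fin K) :
    ∑ j, coordDiv K (comparator K T i j) (1 / K) ≤ 2 * (K * Real.log T) := by
  have hK' : (0 : ℝ) < K := by exact_mod_cast hK
  have hT' : (0 : ℝ) < T := by exact_mod_cast (by omega : 0 < T)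
  have hT2 : (2 : ℝ) ≤ T := by exact_mod_cast hT
  have hu := comparator_mem hK hT i
  set u := comparator K T i
  have h1 : ∀ j, coordDiv K (u j) (1 / K) ≤ Real.log T + Real.log K -
      (mirrorMap K (1 / K) + K) * (u j - 1 / K) := by
    intro j
    have hge : 1 / (T * K : ℝ) ≤ u j := by
      have h0 : 0 ≤ 1 - 1 / (T : ℝ) := by
        rw [sub_nonneg, div_le_one (by linarith)]
        linarith
      change _ ≤ comparator K T i j
      unfold comparator
      split_ifs <;> linarith
    have hlog : -Real.log (u j) ≤ Real.log T + Real.log K := by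
      have := Real.log_le_log (by positivity) hge
      rw [one_div, Real.log_inv, Real.log_mul hT'.ne' hK'.ne'] at this
      linarith
    have hneg : K * (u j * Real.log (u j)) ≤ 0 :=
      mul_nonpos_of_nonneg_of_nonpos hK'.le (mul_nonpos_of_nonneg_of_nonpos (hu.1 j).le
        (Real.log_nonpos (hu.1 j).le (simplex_le_one hu j)))
    have hy : -Real.log (1 / (K : ℝ)) + K * (1 / K * Real.log (1 / K)) = 0 := by
      field_simp
      ring
    unfold coordDiv
    rw [hy]
    linarith
  have hlogK : Real.log K ≤ Real.log T := Real.log_le_log hK' (by exact_mod_cast hKT)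
  refine (Finset.sum_le_sum fun j _ => h1 j).trans ?_
  have h2 : ∑ j, (u j - 1 / (K : ℝ)) = 0 := by
    rw [Finset.sum_sub_distrib, hu.2]
    simp [hK'.ne']
  rw [Finset.sum_sub_distrib, ← Finset.mul_sum, h2]
  simp only [Finset.sum_const, Finset.card_univ, Fintype.card_fin, nsmul_eq_mul]
  nlinarith

theorem regret_le_expSwitchCost [IsProbabilityMeasure μ]
    (h : IsObliviousRun η (8 * η) β T μ loss act) (hη : 0 < η) (hη1 : η ≤ 1 / 162) (hβ : 0 < β)
    (hK : 1 ≤ K) (hT : 2 ≤ T) (hKT : K ≤ T) :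
    regret μ T loss act ≤ 1 + 1 / η * (2 * (K * Real.log T)) + 7 * η +
      8 * η * expSwitchCost η β T μ loss act + 12 * η / (K * β) * pathLength μ T loss := by
  have hadm := admissible_of_run h hη hη1
  refine regret_le_of_forall hK fun i => ?_
  have hu := comparator_mem hK hT i
  have hdev : ∀ t ∈ Finset.range T, _ := fun t ht =>
    integral_deviation (β := β) h hη hη1 (Finset.mem_range.1 ht)
      (G := fun ω => correctedLoss η β (fun s => act s ω) (fun s => loss s ω)
        (comparator K T i) t)
      (fun j => measurable_correctedLoss (mΩ := information T loss act t) hadm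
        (measurable_loss_information t) (Finset.mem_range.1 ht)
        (measurable_act_information t) _ j)
      (fun ω j => abs_correctedLoss_le (hadm ω) (Finset.mem_range.1 ht) hu j)
  have hV := integrable_pathLength h hη hη1
  have hP := integrable_switchCost h hη hη1
  have hint : Integrable (fun ω => 1 + 1 / η * (2 * (K * Real.log T)) + 7 * η +
      8 * η * ∑ t ∈ Finset.Ico 1 T, switchCost η β (fun s => act s ω) (fun s => loss s ω) t) μ :=
    (integrable_const _).add (hP.const_mul _)
  have hint2 : Integrable (fun ω => 12 * η / (K * β) * ∑ t ∈ Finset.Icc 1 T, ∑ i,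
      lossChange (fun s => loss s ω) t i) μ := hV.const_mul _
  have hint' := integrable_finsetSum _ fun t ht => (hdev t ht).1
  have hLint : Integrable (fun ω => ∑ t ∈ Finset.Icc 1 T, loss t ω (act t ω) -
      ∑ t ∈ Finset.Icc 1 T, loss t ω i) μ :=
    (integrable_finsetSum _ fun t ht => integrable_loss_act h ht).sub
      (integrable_finsetSum _ fun t ht => integrable_loss h ht i)
  refine (integral_mono hLint ((hint.add hint2).add hint') fun ω => ?_).trans (le_of_eq ?_)
  · have h1 := sum_loss_le (β := β) (a := fun s => act s ω) (hadm ω) hβ (by omega) hu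
    have h2 : ∑ t ∈ Finset.range T, ∑ j, comparator K T i j * loss (t + 1) ω j ≤
        ∑ t ∈ Finset.range T, loss (t + 1) ω i + 1 := by
      have h3 : ∑ t ∈ Finset.range T, ∑ j, comparator K T i j * loss (t + 1) ω j ≤
          ∑ t ∈ Finset.range T, (loss (t + 1) ω i + 1 / T) :=
        Finset.sum_le_sum fun t ht => comparator_loss_le hK hT i
          fun j => h.loss_mem _ (Finset.mem_Icc.2 ⟨by omega, Finset.mem_range.1 ht⟩) ω j
      refine h3.trans (le_of_eq ?_)
      have hT' : (T : ℝ) ≠ 0 := by exact_mod_cast (by omega : T ≠ 0)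
      rw [Finset.sum_add_distrib, Finset.sum_const, Finset.card_range, nsmul_eq_mul,
        mul_one_div_cancel hT']
    have h4 : 1 / η * ∑ j, coordDiv K (comparator K T i j) (1 / K) ≤
        1 / η * (2 * (K * Real.log T)) := by
      gcongr
      exact sum_coordDiv_comparator_le hK hT hKT i
    have hre : ∀ f : ℕ → ℝ, ∑ t ∈ Finset.Icc 1 T, f t = ∑ t ∈ Finset.range T, f (t + 1) := by
      intro f
      rw [Finset.range_eq_Ico, Finset.sum_Ico_add' f 0 T 1]
      rfl
    simp only [Pi.add_apply]
    rw [hre (fun t => loss t ω (act t ω)), hre (fun t => loss t ω i)]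
    linarith
  · rw [integral_add' (hint.add hint2) hint', integral_finsetSum _ fun t ht => (hdev t ht).1,
      Finset.sum_eq_zero fun t ht => (hdev t ht).2, add_zero, integral_add' hint hint2,
      integral_add (integrable_const _) (hP.const_mul _), integral_const_mul,
      integral_const_mul, ← pathLength_eq, ← expSwitchCost]
    simp

end Expectation

/-! ### Tuning -/

section Tuning

variable {K : ℕ} {Ω : Type*} [MeasurableSpace Ω] {η β : ℝ} {T : ℕ} {μ : Measure Ω}
  {loss : ℕ → Ω → Fin K → ℝ} {act : ℕ → Ω → Fin K}

theorem expSwitchCost_le [IsProbabilityMeasure μ]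
    (h : IsObliviousRun η (8 * η) β T μ loss act) (hη : 0 < η) (hη1 : η ≤ 1 / 162) (hβ : 0 < β)
    (hT : 1 ≤ T) :
    expSwitchCost η β T μ loss act ≤ 2 + 12 * √(β * T * pathLength μ T loss) := by
  have hblock := fun {L : ℕ} (hL : 1 ≤ L) => expSwitchCost_le_blocks h hη hη1 hβ hT hL
  have hround := expSwitchCost_le_rounds h hη hη1
  have hV0 := pathLength_nonneg (μ := μ) (T := T) (loss := loss)
  set V := pathLength μ T loss
  set P := expSwitchCost η β T μ loss act
  set W := √(β * T * V) with hWdef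
  have hW0 : 0 ≤ W := Real.sqrt_nonneg _
  have hT' : (1 : ℝ) ≤ T := by exact_mod_cast hT
  have hWsq : W ^ 2 = β * T * V := Real.sq_sqrt (by positivity)
  have hfin : (1 - 8 * η) * P ≤ 1 + 10 * W → P ≤ 2 + 12 * W := by
    intro h1
    by_contra! h2
    nlinarith
  rcases hV0.eq_or_lt with hV | hV
  · -- a single block suffices
    refine hfin ?_
    have h1 := hblock (L := T + 1) (by omega)
    rw [Nat.div_eq_of_lt (Nat.lt_succ_self T), ← hV] at h1
    simp only [Nat.cast_zero, mul_zero] at h1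
    linarith
  · rcases le_or_gt (T : ℝ) (β * V) with hcase | hcase
    · have h1 : (T : ℝ) ≤ W := by
        refine Real.le_sqrt_of_sq_le ?_
        nlinarith
      linarith
    · -- blocks of length `√(T / (β V))` balance the two terms
      refine hfin ?_
      have hβV : 0 < β * V := mul_pos hβ hV
      have hWge : β * V ≤ W := by
        refine Real.le_sqrt_of_sq_le ?_
        nlinarith
      have hWpos : 0 < W := hβV.trans_le hWge
      set r := W / (β * V) with hr
      have hr1 : 1 ≤ r := by rwa [hr, one_le_div hβV]
      have hrV : r * (β * V) = W := div_mul_cancel₀ _ hβV.ne'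
      have hL1 : 1 ≤ ⌈r⌉₊ := Nat.one_le_ceil_iff.2 (by linarith)
      have hL2 : (⌈r⌉₊ : ℝ) ≤ 2 * r := by
        have := Nat.ceil_lt_add_one (show 0 ≤ r by linarith)
        linarith
      have hL3 : r ≤ ⌈r⌉₊ := Nat.le_ceil r
      have h1 := hblock hL1
      have h2 : ((T / ⌈r⌉₊ : ℕ) : ℝ) ≤ W := by
        refine Nat.cast_div_le.trans ?_
        rw [div_le_iff₀ (by linarith)]
        have h3 : W * r ≤ W * ⌈r⌉₊ := by gcongr
        have h4 : W * r = T := by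
          rw [hr, ← mul_div_assoc, ← sq, hWsq]
          field_simp
        linarith
      have h5 : 4 * β * (⌈r⌉₊ * V) ≤ 8 * W := by
        have : (⌈r⌉₊ : ℝ) * (β * V) ≤ 2 * r * (β * V) := by gcongr
        nlinarith
      linarith

theorem regret_le [IsProbabilityMeasure μ] (hK : 1 ≤ K) (hT : 2 ≤ T)
    (h : IsObliviousRun η (8 * η) β T μ loss act) (hη : 0 < η) (hη1 : η ≤ 1 / 162)
    (hβ : 0 < β) :
    regret μ T loss act ≤ 100 * (K * Real.log T / η + η * pathLength μ T loss / (K * β)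
      + η * √(β * T * pathLength μ T loss)) := by
  have hK' : (1 : ℝ) ≤ K := by exact_mod_cast hK
  have hlog : 1 / 2 ≤ Real.log T := by
    have h1 := Real.log_two_gt_d9
    have h2 : Real.log 2 ≤ Real.log T := Real.log_le_log (by norm_num) (by exact_mod_cast hT)
    linarith
  have hV0 := pathLength_nonneg (μ := μ) (T := T) (loss := loss)
  have hbig : 81 * (K : ℝ) ≤ K * Real.log T / η := by
    rw [le_div_iff₀ hη]
    nlinarith
  have h1 : 0 ≤ η * pathLength μ T loss / (K * β) := by positivity
  have h2 : 0 ≤ η * √(β * T * pathLength μ T loss) := by positivity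
  rcases le_or_gt K T with hKT | hKT
  · have hmain := regret_le_expSwitchCost h hη hη1 hβ hK hT hKT
    have hsw := expSwitchCost_le h hη hη1 hβ (by omega)
    have hsw' : 8 * η * expSwitchCost η β T μ loss act ≤
        8 * η * (2 + 12 * √(β * T * pathLength μ T loss)) := by gcongr
    have e1 : 12 * η / (K * β) * pathLength μ T loss =
        12 * (η * pathLength μ T loss / (K * β)) := by ring
    have e2 : 1 / η * (2 * (K * Real.log T)) = 2 * (K * Real.log T / η) := by ring
    linarith
  · have hTr := regret_le_rounds hK h
    have hKT' : (T : ℝ) ≤ K := by exact_mod_cast hKT.le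
    linarith

end Tuning

theorem exists_root {y : ℝ} (hy : 0 < y) {n : ℕ} (hn : n ≠ 0) :
    ∃ z : ℝ, 0 < z ∧ y = z ^ n ∧ y ^ (1 / (n : ℝ)) = z :=
  ⟨y ^ (1 / (n : ℝ)), Real.rpow_pos_of_pos hy _, by
    rw [one_div, Real.rpow_inv_natCast_pow hy.le hn], rfl⟩

/-- The choice of `η` and `β` that balances the three terms of the regret bound. In terms of the
roots `k = K^(1/3)`, `v = V^(1/3)` and `s = T^(1/6)` it is `β = v / (k² s²)` and `η = k² / (v s)`,
up to the constraints on the range. -/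
theorem exists_tuning {K T : ℕ} (hK : 1 ≤ K) (hT : 2 ≤ T) {V : ℝ} (hV : 0 ≤ V)
    (hVle : V ≤ K * T) :
    ∃ η β : ℝ, 0 < η ∧ η ≤ min (1 / (K : ℝ)) (1 / 162) ∧ 0 < β ∧ β < 1 ∧
      K * Real.log T / η + η * V / (K * β) + η * √(β * T * V) ≤
        162 * Real.log T *
          ((K : ℝ) ^ (1 / 3 : ℝ) * V ^ (1 / 3 : ℝ) * (T : ℝ) ^ (1 / 6 : ℝ) + (K : ℝ) ^ 2) := by
  have hK' : (1 : ℝ) ≤ K := by exact_mod_cast hK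
  have hK0 : (0 : ℝ) < K := by linarith
  have hT0 : (0 : ℝ) < T := by exact_mod_cast (by omega : 0 < T)
  have hlog : 1 / 2 ≤ Real.log T := by
    have h1 := Real.log_two_gt_d9
    have h2 : Real.log 2 ≤ Real.log T := Real.log_le_log (by norm_num) (by exact_mod_cast hT)
    linarith
  have hη₀ : 0 < min (1 / (K : ℝ)) (1 / 162) := lt_min (by positivity) (by norm_num)
  -- `1 / min (1 / K) (1 / 162) = max K 162`
  have hdiv : (K : ℝ) / min (1 / (K : ℝ)) (1 / 162) ≤ 162 * K ^ 2 := by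
    rw [div_le_iff₀ hη₀]
    rcases min_choice (1 / (K : ℝ)) (1 / 162) with h | h <;> rw [h]
    · have : 162 * (K : ℝ) ^ 2 * (1 / K) = 162 * K := by field_simp
      linarith
    · nlinarith
  rcases hV.eq_or_lt with rfl | hVpos
  · refine ⟨min (1 / (K : ℝ)) (1 / 162), 1 / 2, hη₀, le_rfl, by norm_num, by norm_num, ?_⟩
    rw [Real.zero_rpow (by norm_num)]
    simp only [mul_zero, zero_div, Real.sqrt_zero, add_zero, zero_mul, zero_add]
    have e : K * Real.log T / min (1 / (K : ℝ)) (1 / 162) =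
        Real.log T * (K / min (1 / (K : ℝ)) (1 / 162)) := by ring
    rw [e]
    nlinarith
  obtain ⟨k, hk0, hk, hk'⟩ := exists_root hK0 (n := 3) (by norm_num)
  obtain ⟨v, hv0, hv, hv'⟩ := exists_root hVpos (n := 3) (by norm_num)
  obtain ⟨s, hs0, hs, hs'⟩ := exists_root hT0 (n := 6) (by norm_num)
  have hM : (K : ℝ) ^ (1 / 3 : ℝ) * V ^ (1 / 3 : ℝ) * (T : ℝ) ^ (1 / 6 : ℝ) = k * v * s := by
    rw [← hk', ← hv', ← hs']
    norm_num
  rw [hM]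
  have hk1 : 1 ≤ k := by
    by_contra! hlt
    have := pow_lt_one₀ hk0.le hlt (n := 3) (by norm_num)
    linarith
  have hvle : v ≤ k ^ 2 * s ^ 2 := by
    have h1 : v ≤ k * s ^ 2 := by
      refine le_of_pow_le_pow_left₀ (n := 3) (by norm_num) (by positivity) ?_
      calc v ^ 3 = V := hv.symm
        _ ≤ K * T := hVle
        _ = (k * s ^ 2) ^ 3 := by
          rw [hk, hs]
          ring
    have h2 : k * s ^ 2 ≤ k ^ 2 * s ^ 2 := by
      gcongr
      nlinarith
    linarith
  set β₀ := v / (k ^ 2 * s ^ 2) with hβ₀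
  have hβ₀pos : 0 < β₀ := by positivity
  have hβ₀le : β₀ ≤ 1 := by
    rw [hβ₀, div_le_one (by positivity)]
    exact hvle
  set η₁ := k ^ 2 / (v * s) with hη₁
  have hη₁pos : 0 < η₁ := by positivity
  set A := v ^ 2 * s ^ 2 / k with hA
  have hApos : 0 < A := by positivity
  have hηA : η₁ * A = k * v * s := by
    rw [hη₁, hA]
    field_simp
  refine ⟨min (min (1 / (K : ℝ)) (1 / 162)) η₁, min β₀ (1 / 2), lt_min hη₀ hη₁pos,
    min_le_left _ _, lt_min hβ₀pos (by norm_num), (min_le_right _ _).trans_lt (by norm_num), ?_⟩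
  set β := min β₀ (1 / 2) with hβ
  have hβpos : 0 < β := lt_min hβ₀pos (by norm_num)
  have hβge : β₀ / 2 ≤ β := le_min (by linarith) (by linarith)
  set η := min (min (1 / (K : ℝ)) (1 / 162)) η₁ with hη
  have hηpos : 0 < η := lt_min hη₀ hη₁pos
  have hηle : η ≤ η₁ := min_le_right _ _
  have b1 : K / η ≤ 162 * K ^ 2 + k * v * s := by
    have hc : K / η₁ = k * v * s := by
      rw [hη₁, hk]
      field_simp
    have hd : 0 < (K : ℝ) ^ 2 := by positivity
    have he : 0 < k * v * s := by positivity
    rcases min_choice (min (1 / (K : ℝ)) (1 / 162)) η₁ with h | h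
    · rw [hη, h]
      linarith
    · rw [hη, h]
      linarith
  have b2 : η * V / (K * β) ≤ 2 * (k * v * s) := by
    have h1 : η * V / (K * β) ≤ η₁ * V / (K * (β₀ / 2)) := by gcongr
    have h2 : η₁ * V / (K * (β₀ / 2)) = 2 * (η₁ * A) := by
      rw [hβ₀, hA, hk, hv]
      field_simp
    rw [← hηA, ← h2]
    exact h1
  have b3 : η * √(β * T * V) ≤ k * v * s := by
    have h1 : √(β * T * V) ≤ A := by
      refine Real.sqrt_le_iff.2 ⟨hApos.le, ?_⟩
      have h2 : β * T * V ≤ β₀ * T * V := by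
        gcongr
        exact min_le_left _ _
      have h3 : β₀ * T * V = A ^ 2 := by
        rw [hβ₀, hA, hs, hv]
        field_simp
      linarith
    rw [← hηA]
    gcongr
  have e : K * Real.log T / η = Real.log T * (K / η) := by ring
  have b4 : Real.log T * (K / η) ≤ Real.log T * (162 * K ^ 2 + k * v * s) := by gcongr
  have hMpos : 0 < k * v * s := by positivity
  rw [e]
  nlinarith

theorem main_term_le_sqrt {K T : ℕ} (hK : 1 ≤ K) (hT : 2 ≤ T) {V : ℝ} (hV : (T : ℝ) / K ≤ V) :
    (K : ℝ) ^ (1 / 3 : ℝ) * V ^ (1 / 3 : ℝ) * (T : ℝ) ^ (1 / 6 : ℝ) ≤ √(K * V) ∧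
    ((T : ℝ) / K < V →
      (K : ℝ) ^ (1 / 3 : ℝ) * V ^ (1 / 3 : ℝ) * (T : ℝ) ^ (1 / 6 : ℝ) < √(K * V)) := by
  have hK0 : (0 : ℝ) < K := by exact_mod_cast hK
  have hT0 : (0 : ℝ) < T := by exact_mod_cast (by omega : 0 < T)
  have hVpos : 0 < V := lt_of_lt_of_le (by positivity) hV
  obtain ⟨k, hk0, hk, hk'⟩ := exists_root hK0 (n := 3) (by norm_num)
  obtain ⟨v, hv0, hv, hv'⟩ := exists_root hVpos (n := 3) (by norm_num)
  obtain ⟨s, hs0, hs, hs'⟩ := exists_root hT0 (n := 6) (by norm_num)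
  have hM : (K : ℝ) ^ (1 / 3 : ℝ) * V ^ (1 / 3 : ℝ) * (T : ℝ) ^ (1 / 6 : ℝ) = k * v * s := by
    rw [← hk', ← hv', ← hs']
    norm_num
  have e1 : (k * v * s) ^ 2 = (k * v) ^ 2 * s ^ 2 := by ring
  have e2 : (K : ℝ) * V = (k * v) ^ 2 * (k * v) := by
    rw [hk, hv]
    ring
  have e3 : (s ^ 2) ^ 3 = (T : ℝ) := by
    rw [hs]
    ring
  have e4 : (k * v) ^ 3 = K * V := by
    rw [hk, hv]
    ring
  rw [hM]
  constructor
  · refine Real.le_sqrt_of_sq_le ?_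
    rw [e1, e2]
    gcongr
    refine le_of_pow_le_pow_left₀ (n := 3) (by norm_num) (by positivity) ?_
    rw [e3, e4, mul_comm]
    exact (div_le_iff₀ hK0).1 hV
  · intro hlt
    refine Real.lt_sqrt_of_sq_lt ?_
    rw [e1, e2]
    gcongr
    refine lt_of_pow_lt_pow_left₀ 3 (by positivity) ?_
    rw [e3, e4, mul_comm]
    exact (div_lt_iff₀ hK0).1 hlt

end PathLengthBandit

end

theorem theorem3 :
    (∃ C : ℝ, 0 < C ∧
      ∀ (K T : ℕ), 1 ≤ K → 2 ≤ T →
      ∀ (η β : ℝ), 0 < η → η ≤ min (1 / (K : ℝ)) (1 / 162) → 0 < β → β < 1 →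
      ∀ (Ω : Type*) [MeasurableSpace Ω] (μ : Measure Ω) [IsProbabilityMeasure μ]
        (loss : ℕ → Ω → Fin K → ℝ) (act : ℕ → Ω → Fin K),
        PathLengthBandit.IsObliviousRun η (8 * η) β T μ loss act →
        PathLengthBandit.regret μ T loss act ≤
          C * (K * Real.log T / η
            + η * PathLengthBandit.pathLength μ T loss / (K * β)
            + η * √(β * T * PathLengthBandit.pathLength μ T loss))) ∧
    (∃ (C : ℝ) (p : ℕ), 0 < C ∧
      ∀ (K T : ℕ), 1 ≤ K → 2 ≤ T → ∀ V : ℝ, 0 ≤ V →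
      ∃ η β : ℝ, 0 < η ∧ η ≤ min (1 / (K : ℝ)) (1 / 162) ∧ 0 < β ∧ β < 1 ∧
      ∀ (Ω : Type*) [MeasurableSpace Ω] (μ : Measure Ω) [IsProbabilityMeasure μ]
        (loss : ℕ → Ω → Fin K → ℝ) (act : ℕ → Ω → Fin K),
        PathLengthBandit.IsObliviousRun η (8 * η) β T μ loss act →
        PathLengthBandit.pathLength μ T loss = V →
        PathLengthBandit.regret μ T loss act ≤
          C * Real.log T ^ p *
            ((K : ℝ) ^ (1 / 3 : ℝ) * V ^ (1 / 3 : ℝ) * (T : ℝ) ^ (1 / 6 : ℝ) + (K : ℝ) ^ 2)) ∧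
    (∀ (K T : ℕ), 1 ≤ K → 2 ≤ T → ∀ V : ℝ,
      ((T : ℝ) / K ≤ V →
        (K : ℝ) ^ (1 / 3 : ℝ) * V ^ (1 / 3 : ℝ) * (T : ℝ) ^ (1 / 6 : ℝ) ≤ √(K * V)) ∧
      ((T : ℝ) / K < V →
        (K : ℝ) ^ (1 / 3 : ℝ) * V ^ (1 / 3 : ℝ) * (T : ℝ) ^ (1 / 6 : ℝ) < √(K * V))) := by
  refine ⟨⟨100, by norm_num, ?_⟩, ⟨16200, 1, by norm_num, ?_⟩, ?_⟩
  · intro K T hK hT η β hη hη1 hβ _ Ω _ μ _ loss act h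
    exact PathLengthBandit.regret_le hK hT h hη (hη1.trans (min_le_right _ _)) hβ
  · intro K T hK hT V hV
    by_cases hVle : V ≤ K * T
    · obtain ⟨η, β, hη, hη1, hβ, hβ1, hle⟩ := PathLengthBandit.exists_tuning hK hT hV hVle
      refine ⟨η, β, hη, hη1, hβ, hβ1, fun Ω _ μ _ loss act h hpl => ?_⟩
      have hreg := PathLengthBandit.regret_le hK hT h hη (hη1.trans (min_le_right _ _)) hβ
      rw [hpl] at hreg
      rw [pow_one]
      linarith
    · -- losses in `[0, 1]` cannot have a path length above `K T`
      refine ⟨min (1 / (K : ℝ)) (1 / 162), 1 / 2, ?_, le_rfl, by norm_num, by norm_num,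
        fun Ω _ μ _ loss act h hpl => absurd ?_ hVle⟩
      · have : (0 : ℝ) < K := by exact_mod_cast hK
        exact lt_min (by positivity) (by norm_num)
      · rw [← hpl]
        have : (0 : ℝ) < K := by exact_mod_cast hK
        exact PathLengthBandit.pathLength_le h (lt_min (by positivity) (by norm_num))
          (min_le_right _ _)
  · intro K T hK hT V
    exact ⟨fun hV => (PathLengthBandit.main_term_le_sqrt hK hT hV).1,
      fun hV => (PathLengthBandit.main_term_le_sqrt hK hT hV.le).2 hV⟩
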